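/- **Setting.** Put $\varphi_0(Z)=e^{Z}$ and $\varphi_k(Z)=\int_0^1 e^{(1-\theta)Z}\frac{\theta^{k-1}}{(k-1)!}\,d\theta$ for $k\ge1$, where $Z$ is a square matrix or $Z=hJ$ with $h\ge0$ and $J$ the generator of a strongly continuous semigroup $(e^{tJ})_{t\ge0}$ (the integral then being taken pointwise). Let $X$ be a real Banach space (a complex one being regarded as a real one), $A$ a linear operator in $X$ with domain $D(A)$, $g:X\to X$, and $t_0<T$. Assume: 1. $A$ is the generator of a strongly continuous semigroup $e^{tA}$ in $X$. 2. $u:[t_0,T]\to X$ is a solution of $u'(t)=F(u(t))=Au(t)+g(u(t))$ (with $u(t)\in D(A)$) of class $C^4$; for some $r>0$, $g$ is of class $C^4$ in the strip $\{v:\operatorname{dist}(v,u([t_0,T]))<r\}$; and the derivatives of orders $1,\dots,4$ of $u$ on $[t_0,T]$ and of $g$ in the strip are bounded in norm by a constant $K$. 3. For every $t\in[t_0,T]$ the element $g'''(u(t))(u'(t),u'(t),u'(t))+3g''(u(t))(u'(t),u''(t))$ lies in $D(A)$, and $\big\|A\big(g'''(u(t))(u'(t),u'(t),u'(t))+3g''(u(t))(u'(t),u''(t))\big)\big\|\le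 K$. For $v\in D(A)$ with $g$ differentiable at $v$, let $J(v)=A+g'(v)$ (with domain $D(A)$) and $g_v(w)=g(w)-g'(v)w$. A 2-stage explicit exponential Rosenbrock method is given by a node $c_2\in\mathbb R$ and a function $b_2$ that is a finite real linear combination of the functions $z\mapsto\varphi_k(\sigma z)$ with $k\ge0$, $\sigma\ge0$. Its step of size $h$ from $v$ is $$U=v+c_2h\,\varphi_1(c_2hJ(v))F(v),\qquad \Phi_h(v)=v+h\,\varphi_1(hJ(v))F(v)+h\,b_2(hJ(v))\big(g_v(U)-g_v(v)\big).$$ The local error at $t$ with step size $h$ is $\tilde e(t,h)=\Phi_h(u(t))-u(t+h)$. Consider the order conditions $$b_2(Z)\,c_2^2=2\varphi_3(Z)\ \text{ for every square matrix } Z,\qquad b_2(0)\,c_2^3=6\varphi_4(0).\tag{$*$}$$ **Lemma 4.1.** (a) Among all real numbers $c_2$ and all functions $b_2$ that map square matrices (with entries in $\mathbb R$ or in $\mathbb C$) to square matrices of the same size, $(*)$ has the unique solution $c_2=\frac34$, $b_2=\frac{32}{9}\varphi_3$. (b) Let a 2-stage explicit exponential Rosenbrock method satisfy $(*)$. Under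 assumptions 1–3, $J(u(t))$ generates a strongly continuous semigroup for every $t\in[t_0,T]$, there are $M,\omega$ with $\|e^{sA}\|\le Me^{\omega s}$ for all $s\ge0$, and the method has order of consistency five: for any such $M,\omega$ there are constants $C$ and $h_0>0$ such that $$\|\tilde e(t,h)\|\le C\,h^5\qquad\text{for all } t\in[t_0,T],\ 0<h\le h_0 \text{ with } t+h\le T.$$ For a given method, $C$ and $h_0$ depend only on $M,\omega,r,K$; in particular $C$ is independent of $h$ and of the grid point $t=t_n$, so that $\tilde e_{n+1}=\tilde e(t_n,h)=\mathcal O(h^5)$ uniformly in $n$. -/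

import Mathlib

open Set Filter Topology
open scoped Nat NNReal

noncomputable section

/-! ### Strongly continuous semigroups and their generators -/

section Semigroup

variable {X : Type*} [NormedAddCommGroup X] [NormedSpace ℝ X]

/-- `(S t)_{t ≥ 0}` is a strongly continuous (C₀) semigroup of bounded operators on `X`.
Values of `S` at negative times play no role. -/
structure IsC0Semigroup (S : ℝ → X →L[ℝ] X) : Prop where
  map_zero : S 0 = ContinuousLinearMap.id ℝ X
  map_add : ∀ s t : ℝ, 0 ≤ s → 0 ≤ t → S (s + t) = (S s).comp (S t)
  tendsto_zero : ∀ x : X, Tendsto (fun t : ℝ => S t x) (𝓝[>] 0) (𝓝 x)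

/-- `A` (an unbounded operator with domain `A.domain`) is the infinitesimal generator of `S`:
`x ∈ D(A)` and `A x = y` exactly when `(S t x - x) / t → y` as `t → 0+`. -/
def IsGeneratorOf (A : X →ₗ.[ℝ] X) (S : ℝ → X →L[ℝ] X) : Prop :=
  ∀ x y : X, (∃ hx : x ∈ A.domain, A ⟨x, hx⟩ = y) ↔
    Tendsto (fun t : ℝ => t⁻¹ • (S t x - x)) (𝓝[>] 0) (𝓝 y)

/-- `A` generates a strongly continuous semigroup. -/
def GeneratesC0Semigroup (A : X →ₗ.[ℝ] X) : Prop :=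
  ∃ S : ℝ → X →L[ℝ] X, IsC0Semigroup S ∧ IsGeneratorOf A S

open Classical in
/-- The semigroup `t ↦ e^{tA}` generated by `A` (for `t ≥ 0` it is determined by `A`);
the zero family if `A` is not a generator. -/
def expSemigroup (A : X →ₗ.[ℝ] X) : ℝ → X →L[ℝ] X :=
  if h : GeneratesC0Semigroup A then h.choose else fun _ => 0

/-- `φ_k(hA)` for a generator `A`:
`φ_0(hA) = e^{hA}` and `φ_k(hA) x = ∫_0^1 θ^{k-1}/(k-1)! e^{(1-θ)hA} x dθ` for `k ≥ 1`. -/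
def phiOp (A : X →ₗ.[ℝ] X) (h : ℝ) : ℕ → X → X
  | 0, x => expSemigroup A h x
  | k + 1, x => ∫ θ in (0 : ℝ)..1, (θ ^ k / (k ! : ℝ)) • expSemigroup A ((1 - θ) * h) x

end Semigroup

/-! ### The entire functions `φ_k` on square matrices -/

/-- `φ_k(Z)` for a square matrix `Z`: `φ_0(Z) = e^Z` and
`φ_k(Z) = ∫_0^1 θ^{k-1}/(k-1)! e^{(1-θ)Z} dθ` (integrated entrywise) for `k ≥ 1`. -/
def phiMat {𝕜 : Type*} [RCLike 𝕜] {m : ℕ} :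
    ℕ → Matrix (Fin m) (Fin m) 𝕜 → Matrix (Fin m) (Fin m) 𝕜
  | 0, Z => NormedSpace.exp Z
  | k + 1, Z => Matrix.of fun i j =>
      ∫ θ in (0 : ℝ)..1, (θ ^ k / (k ! : ℝ)) • (NormedSpace.exp ((1 - θ) • Z)) i j

/-! ### The coefficient function `b₂` -/

/-- A coefficient function `b(z) = ∑ r · φ_k(σ z)`, a finite real linear combination of the
functions `φ_k(σ z)`, `k ≥ 0`, `σ ≥ 0`; the coefficient `r` of `φ_k(σ z)` is `b (k, σ)`. -/
abbrev PhiCombination : Type := (ℕ × ℝ≥0) →₀ ℝ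

/-- `b(Z)` for a square matrix `Z`. -/
def PhiCombination.onMatrix (b : PhiCombination) {𝕜 : Type*} [RCLike 𝕜] (m : ℕ)
    (Z : Matrix (Fin m) (Fin m) 𝕜) : Matrix (Fin m) (Fin m) 𝕜 :=
  Finsupp.sum b fun p r => r • phiMat p.1 ((p.2 : ℝ) • Z)

/-- `b(hA)` for a generator `A`. -/
def PhiCombination.onGenerator (b : PhiCombination) {X : Type*} [NormedAddCommGroup X]
    [NormedSpace ℝ X] (A : X →ₗ.[ℝ] X) (h : ℝ) (x : X) : X :=
  Finsupp.sum b fun p r => r • phiOp A ((p.2 : ℝ) * h) p.1 x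

/-- The stiff order conditions `b(Z) c² = 2 φ_3(Z)` for every square matrix `Z`, and
`b(0) c³ = 6 φ_4(0)`. -/
def StiffOrderConditions {𝕜 : Type*} [RCLike 𝕜]
    (b : (m : ℕ) → Matrix (Fin m) (Fin m) 𝕜 → Matrix (Fin m) (Fin m) 𝕜) (c : ℝ) : Prop :=
  (∀ (m : ℕ) (Z : Matrix (Fin m) (Fin m) 𝕜), c ^ 2 • b m Z = (2 : ℝ) • phiMat 3 Z) ∧
  (∀ m : ℕ, c ^ 3 • b m 0 = (6 : ℝ) • phiMat 4 (0 : Matrix (Fin m) (Fin m) 𝕜))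

/-! ### The scheme and the assumptions on the problem `u' = A u + g(u)` -/

section Problem

variable {X : Type*} [NormedAddCommGroup X] [NormedSpace ℝ X]

/-- The Jacobian `J(v) = A + g'(v)`, with domain `D(A)`. -/
def jacobian (A : X →ₗ.[ℝ] X) (g : X → X) (v : X) : X →ₗ.[ℝ] X :=
  ((fderiv ℝ g v : X →L[ℝ] X) : X →ₗ[ℝ] X) +ᵥ A

/-- The remainder of the linearization at `v`: `w ↦ F(w) - J(v) w = g(w) - g'(v) w`. -/
def linRemainder (g : X → X) (v w : X) : X := g w - fderiv ℝ g v w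

/-- The vector field `F(v) = A v + g(v)`, `v ∈ D(A)`. -/
def vectorField (A : X →ₗ.[ℝ] X) (g : X → X) (v : A.domain) : X := A v + g v

/-- The internal stage `U = v + c h φ_1(c h J(v)) F(v)`. -/
def rosenbrockStage (A : X →ₗ.[ℝ] X) (g : X → X) (c h : ℝ) (v : A.domain) : X :=
  v + (c * h) • phiOp (jacobian A g v) (c * h) 1 (vectorField A g v)

/-- One step of size `h` from `v` of the 2-stage explicit exponential Rosenbrock method with node
`c` and weight `b`: `v + h φ_1(h J(v)) F(v) + h b(h J(v)) (g_v(U) - g_v(v))`,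
where `g_v = F - J(v)`. -/
def rosenbrockStep (A : X →ₗ.[ℝ] X) (g : X → X) (c : ℝ) (b : PhiCombination) (h : ℝ)
    (v : A.domain) : X :=
  v + h • phiOp (jacobian A g v) h 1 (vectorField A g v)
    + h • b.onGenerator (jacobian A g v) h
        (linRemainder g v (rosenbrockStage A g c h v) - linRemainder g v v)

/-- `u : [t₀, T] → X` is a solution of `u' = A u + g(u)` of class `C⁴`, `g` is of class `C⁴` in the
strip of radius `r` along `u`, and the derivatives of orders `1, …, 4` of `u` on `[t₀, T]` and of
`g` in the strip are bounded by `K`. -/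
structure SmoothSolution (A : X →ₗ.[ℝ] X) (g : X → X) (u : ℝ → X) (t₀ T r K : ℝ) : Prop where
  radius_pos : 0 < r
  contDiffOn_solution : ContDiffOn ℝ 4 u (Icc t₀ T)
  bound_solution : ∀ t ∈ Icc t₀ T, ∀ k ∈ Finset.Icc 1 4,
    ‖iteratedDerivWithin k u (Icc t₀ T) t‖ ≤ K
  contDiffOn_nonlinearity : ContDiffOn ℝ 4 g (Metric.thickening r (u '' Icc t₀ T))
  bound_nonlinearity : ∀ v ∈ Metric.thickening r (u '' Icc t₀ T), ∀ k ∈ Finset.Icc 1 4,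
    ‖iteratedFDeriv ℝ k g v‖ ≤ K
  mem_domain : ∀ t ∈ Icc t₀ T, u t ∈ A.domain
  equation : ∀ (t : ℝ) (ht : t ∈ Icc t₀ T),
    HasDerivWithinAt u (vectorField A g ⟨u t, mem_domain t ht⟩) (Icc t₀ T) t

/-- `g'''(u)(u', u', u') + 3 g''(u)(u', u'')` at time `t`. -/
def regularityTerm (g : X → X) (u : ℝ → X) (t₀ T t : ℝ) : X :=
  let u₁ := iteratedDerivWithin 1 u (Icc t₀ T) t
  let u₂ := iteratedDerivWithin 2 u (Icc t₀ T) t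
  iteratedFDeriv ℝ 3 g (u t) ![u₁, u₁, u₁] + (3 : ℝ) • iteratedFDeriv ℝ 2 g (u t) ![u₁, u₂]

/-- `A (g'''(u)(u', u', u') + 3 g''(u)(u', u''))` is defined and bounded by `K` on `[t₀, T]`. -/
def RegularityCondition (A : X →ₗ.[ℝ] X) (g : X → X) (u : ℝ → X) (t₀ T K : ℝ) : Prop :=
  ∀ t ∈ Icc t₀ T, ∃ hw : regularityTerm g u t₀ T t ∈ A.domain,
    ‖A ⟨regularityTerm g u t₀ T t, hw⟩‖ ≤ K

end Problem

end

/-! Put v = u(t), J = A + g'(v) and D(s) = g_v(u(t+s)) - g_v(v). Around v the equation reads (u -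
v)' = J(u - v) + F(v) + D, so variation of constants gives u(t+h) as the exponential Euler step plus
∫_0^h e^{(h-s)J} D(s) ds. Since g_v'(v) = 0, Taylor expansion yields D(s) = (s²/2)a + (s³/6)w +
O(s⁴) with a = g''(v)(u',u') and w the regularity term, and the integral is h³φ_3(hJ)a + h⁴φ_4(hJ)w
+ O(h⁵).

The stage U is an exponential Euler step of length c₂h, hence O(h³)-accurate. Near v the map g_v has
Lipschitz constant O(h), so g_v(U) - g_v(v) = D(c₂h) + O(h⁴). With c₂ = 3/4 and b₂ = (32/9)φ_3 the
a-terms cancel exactly, without any regularity of a. What remains of the w-terms is h⁴(φ_3/4 -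
φ_4)(hJ)w. The bracket vanishes at 0, and w ∈ D(A) supplies the missing factor h. This is
`SmoothSolution.norm_local_error_le`.

Three facts support the computation. `GeneratesC0Semigroup.vadd` makes J a generator, and
`IsGeneratorOf.norm_le_of_vadd` bounds its semigroup on short intervals in terms of M, ω and K only.
`PhiCombination.onGenerator_eq_of_onMatrix_eq` carries the identity for b₂ from matrices to
generators: 1×1 matrices already test the underlying functional on all e^{ns}, and these span a
dense subspace of C([0,R]). The solution of the order conditions itself comes from comparing the two
at Z = 0. -/

noncomputable section

/-! ### Strongly continuous semigroups, their generators and variation of constants. -/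

section SemigroupTheory

variable {X : Type*} [NormedAddCommGroup X] [NormedSpace ℝ X]

namespace IsC0Semigroup

variable {S : ℝ → X →L[ℝ] X}

theorem exists_bound_near_zero [CompleteSpace X] (hS : IsC0Semigroup S) :
    ∃ δ > 0, ∃ M ≥ 1, ∀ t ∈ Icc (0 : ℝ) δ, ‖S t‖ ≤ M := by
  by_contra! H
  have H' : ∀ n : ℕ, ∃ t ∈ Icc (0 : ℝ) (1 / ((n : ℝ) + 1)), (n : ℝ) + 1 < ‖S t‖ := fun n =>
    H _ (by positivity) _ (by norm_num)
  choose t ht hlt using H'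
  have ht0 : Tendsto t atTop (𝓝 0) :=
    squeeze_zero (fun n => (ht n).1) (fun n => (ht n).2) tendsto_one_div_add_atTop_nhds_zero_nat
  -- Strong continuity concerns positive times only; time 0 is excluded because ‖S 0‖ ≤ 1. The
  -- orbits along `t` are then bounded, and Banach–Steinhaus contradicts ‖S (t n)‖ > n + 1.
  have hpos : ∀ᶠ n in atTop, 0 < t n := by
    filter_upwards [eventually_ge_atTop 1] with n hn
    refine lt_of_le_of_ne (ht n).1 fun h0 => ?_
    have h1 := hlt n
    rw [← h0, hS.map_zero] at h1
    have h2 := ContinuousLinearMap.norm_id_le (𝕜 := ℝ) (E := X)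
    have : (1 : ℝ) ≤ n := by exact_mod_cast hn
    linarith
  have hlim : Tendsto t atTop (𝓝[>] 0) := tendsto_nhdsWithin_iff.2 ⟨ht0, hpos⟩
  obtain ⟨C, hC⟩ := banach_steinhaus (g := fun n => S (t n)) fun x => by
    obtain ⟨C, hC⟩ := ((hS.tendsto_zero x).comp hlim).norm.bddAbove_range
    exact ⟨C, fun n => hC ⟨n, rfl⟩⟩
  obtain ⟨n, hn⟩ := exists_nat_gt C
  have h1 := hlt n
  have h2 := hC n
  linarith

theorem exists_exp_bound [CompleteSpace X] (hS : IsC0Semigroup S) :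
    ∃ M ω : ℝ, ∀ s : ℝ, 0 ≤ s → ‖S s‖ ≤ M * Real.exp (ω * s) := by
  obtain ⟨δ, hδ, M, hM, hb⟩ := hS.exists_bound_near_zero
  have key : ∀ n : ℕ, ∀ t ∈ Icc (0 : ℝ) ((n + 1) * δ), ‖S t‖ ≤ M ^ (n + 1) := by
    intro n
    induction n with
    | zero => intro t ht; simpa using hb t (by simpa using ht)
    | succ n ih =>
      intro t ht
      rcases le_total t δ with h | h
      · exact (hb t ⟨ht.1, h⟩).trans (le_self_pow₀ hM (by omega))
      · have h1 : S t = (S (t - δ)).comp (S δ) := by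
          rw [← hS.map_add _ _ (by linarith) hδ.le, sub_add_cancel]
        rw [h1, pow_succ]
        refine (ContinuousLinearMap.opNorm_comp_le _ _).trans ?_
        refine mul_le_mul (ih _ ⟨by linarith, ?_⟩) (hb δ ⟨hδ.le, le_rfl⟩) (norm_nonneg _)
          (by positivity)
        have := ht.2
        push_cast at this
        linarith
  -- With ω = log M / δ one has e^{ωs} = M^{s/δ}, which dominates M to the number of full steps of
  -- length δ in s.
  refine ⟨M, Real.log M / δ, fun s hs => ?_⟩
  have hf : s ≤ ((⌊s / δ⌋₊ : ℝ) + 1) * δ := by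
    have := (Nat.lt_floor_add_one (s / δ)).le
    rwa [div_le_iff₀ hδ] at this
  refine (key _ s ⟨hs, hf⟩).trans ?_
  rw [pow_succ, mul_comm]
  refine mul_le_mul_of_nonneg_left ?_ (by linarith)
  have hM0 : 0 < M := by linarith
  rw [← Real.exp_log hM0, ← Real.exp_nat_mul, Real.log_exp]
  refine Real.exp_le_exp.2 ?_
  have h2 : (⌊s / δ⌋₊ : ℝ) ≤ s / δ := Nat.floor_le (by positivity)
  have h3 := mul_le_mul_of_nonneg_right h2 (Real.log_nonneg hM)
  calc _ ≤ _ := h3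
    _ = _ := by ring

theorem exists_bound_on [CompleteSpace X] (hS : IsC0Semigroup S) (R : ℝ) :
    ∃ C, 0 ≤ C ∧ ∀ t ∈ Icc (0 : ℝ) R, ‖S t‖ ≤ C := by
  obtain ⟨M, ω, h⟩ := hS.exists_exp_bound
  have hM : 0 ≤ M := by
    have := (norm_nonneg _).trans (h 0 le_rfl)
    simpa using this
  refine ⟨M * Real.exp (|ω| * R), by positivity, fun t ht => (h t ht.1).trans ?_⟩
  refine mul_le_mul_of_nonneg_left (Real.exp_le_exp.2 ?_) hM
  exact (mul_le_mul_of_nonneg_right (le_abs_self ω) ht.1).trans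
    (mul_le_mul_of_nonneg_left ht.2 (abs_nonneg _))

theorem tendsto_zero' (hS : IsC0Semigroup S) (x : X) :
    Tendsto (fun t : ℝ => S t x) (𝓝[≥] 0) (𝓝 x) := by
  rw [← Ioi_union_left, nhdsWithin_union, tendsto_sup]
  refine ⟨hS.tendsto_zero x, ?_⟩
  rw [nhdsWithin_singleton, tendsto_pure_left]
  intro s hs
  rw [hS.map_zero]
  exact mem_of_mem_nhds hs

theorem norm_sub_le (hS : IsC0Semigroup S) {R C : ℝ}
    (hC : ∀ t ∈ Icc (0 : ℝ) R, ‖S t‖ ≤ C) {s t : ℝ} (hs : s ∈ Icc 0 R) (ht : t ∈ Icc 0 R) (x : X) :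
    ‖S t x - S s x‖ ≤ C * ‖S |t - s| x - x‖ := by
  wlog hst : s ≤ t generalizing s t
  · rw [norm_sub_rev, abs_sub_comm]
    exact this ht hs (le_of_not_ge hst)
  have h1 : S t = (S s).comp (S (t - s)) := by
    rw [← hS.map_add _ _ hs.1 (by linarith), add_sub_cancel]
  rw [abs_of_nonneg (by linarith), h1, ContinuousLinearMap.comp_apply, ← map_sub]
  exact ContinuousLinearMap.le_of_opNorm_le _ (hC s hs) _

/-- Joint continuity in time and vector: a uniform bound on [0, t + 1] controls the moving vector,
and `norm_sub_le` reduces increments of time, on either side, to continuity at 0. -/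
theorem tendsto_apply [CompleteSpace X] (hS : IsC0Semigroup S) {ι : Type*} {l : Filter ι}
    {τ : ι → ℝ} {y : ι → X} {t : ℝ} {x : X} (ht : 0 ≤ t) (hτ : Tendsto τ l (𝓝 t))
    (hτ0 : ∀ᶠ i in l, 0 ≤ τ i) (hy : Tendsto y l (𝓝 x)) :
    Tendsto (fun i => S (τ i) (y i)) l (𝓝 (S t x)) := by
  obtain ⟨C, hC0, hC⟩ := hS.exists_bound_on (t + 1)
  rw [tendsto_iff_norm_sub_tendsto_zero]
  have h1 : Tendsto (fun i => ‖S |τ i - t| x - x‖) l (𝓝 0) := by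
    rw [← tendsto_iff_norm_sub_tendsto_zero]
    refine (hS.tendsto_zero' x).comp (tendsto_nhdsWithin_iff.2 ⟨?_, .of_forall fun i => abs_nonneg (τ i - t)⟩)
    have := (hτ.sub_const t).abs
    simpa using this
  have h2 : Tendsto (fun i => ‖y i - x‖) l (𝓝 0) := tendsto_iff_norm_sub_tendsto_zero.1 hy
  have h3 : Tendsto (fun i => C * ‖y i - x‖ + C * ‖S |τ i - t| x - x‖) l (𝓝 0) := by
    simpa using (h2.const_mul C).add (h1.const_mul C)
  refine squeeze_zero' (.of_forall fun i => norm_nonneg _) ?_ h3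
  filter_upwards [hτ0, hτ.eventually (eventually_le_nhds (lt_add_one t))] with i hi0 hi1
  calc ‖S (τ i) (y i) - S t x‖ = ‖S (τ i) (y i - x) + (S (τ i) x - S t x)‖ := by
        rw [map_sub]; congr 1; abel
    _ ≤ _ := norm_add_le _ _
    _ ≤ _ := add_le_add (ContinuousLinearMap.le_of_opNorm_le _ (hC _ ⟨hi0, hi1⟩) _)
      (hS.norm_sub_le hC ⟨ht, by linarith⟩ ⟨hi0, hi1⟩ x)

theorem continuousOn_apply [CompleteSpace X] (hS : IsC0Semigroup S) {α : Type*}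
    [TopologicalSpace α] {s : Set α} {τ : α → ℝ} {y : α → X} (hτ : ContinuousOn τ s)
    (hτ0 : ∀ a ∈ s, 0 ≤ τ a) (hy : ContinuousOn y s) :
    ContinuousOn (fun a => S (τ a) (y a)) s := fun a ha =>
  hS.tendsto_apply (hτ0 a ha) (hτ a ha) (eventually_nhdsWithin_of_forall hτ0) (hy a ha)

theorem continuous_apply [CompleteSpace X] (hS : IsC0Semigroup S) {α : Type*}
    [TopologicalSpace α] {τ : α → ℝ} {y : α → X} (hτ : Continuous τ)
    (hτ0 : ∀ a, 0 ≤ τ a) (hy : Continuous y) :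
    Continuous (fun a => S (τ a) (y a)) := by
  rw [← continuousOn_univ] at *
  exact hS.continuousOn_apply hτ (fun a _ => hτ0 a) hy

end IsC0Semigroup

variable {S : ℝ → X →L[ℝ] X} {A : X →ₗ.[ℝ] X}

theorem IsGeneratorOf.tendsto (hA : IsGeneratorOf A S) (x : A.domain) :
    Tendsto (fun t : ℝ => t⁻¹ • (S t x - x)) (𝓝[>] 0) (𝓝 (A x)) :=
  (hA x (A x)).1 ⟨x.2, rfl⟩

theorem tendsto_add_const_nhdsGT (s : ℝ) : Tendsto (fun δ => s + δ) (𝓝[>] 0) (𝓝[>] s) := by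
  refine tendsto_nhdsWithin_iff.2 ⟨?_, ?_⟩
  · have : Tendsto (fun δ : ℝ => s + δ) (𝓝 0) (𝓝 (s + 0)) := (continuous_const.add continuous_id).tendsto 0
    rw [add_zero] at this
    exact this.mono_left nhdsWithin_le_nhds
  · exact eventually_nhdsWithin_of_forall fun δ hδ => by simpa using hδ

theorem tendsto_sub_const_nhdsGT (s : ℝ) : Tendsto (fun r => r - s) (𝓝[>] s) (𝓝[>] 0) := by
  refine tendsto_nhdsWithin_iff.2 ⟨?_, ?_⟩
  · have : Tendsto (fun r : ℝ => r - s) (𝓝 s) (𝓝 (s - s)) := (continuous_id.sub continuous_const).tendsto s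
    rw [sub_self] at this
    exact this.mono_left nhdsWithin_le_nhds
  · exact eventually_nhdsWithin_of_forall fun δ hδ => by simpa using hδ

theorem hasDerivWithinAt_Ioi_iff_tendsto {y : ℝ → X} {y' : X} {s : ℝ} :
    HasDerivWithinAt y y' (Ioi s) s ↔
      Tendsto (fun δ : ℝ => δ⁻¹ • (y (s + δ) - y s)) (𝓝[>] 0) (𝓝 y') := by
  rw [hasDerivWithinAt_iff_tendsto_slope' self_notMem_Ioi]
  constructor
  · intro h
    refine (h.comp (tendsto_add_const_nhdsGT s)).congr fun δ => ?_
    simp [slope_def_module]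
  · intro h
    refine (h.comp (tendsto_sub_const_nhdsGT s)).congr fun δ => ?_
    simp [slope_def_module]

/-- Orbits of points of the domain stay in the domain. -/
theorem IsGeneratorOf.apply_mem (hS : IsC0Semigroup S) (hA : IsGeneratorOf A S) (x : A.domain)
    {s : ℝ} (hs : 0 ≤ s) : ∃ hx : S s x ∈ A.domain, A ⟨S s x, hx⟩ = S s (A x) := by
  refine (hA _ _).2 ?_
  refine (((S s).continuous.tendsto _).comp (hA.tendsto x)).congr' ?_
  refine eventually_nhdsWithin_of_forall fun δ hδ => ?_
  have h1 : S δ (S s x) = S s (S δ x) := by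
    rw [← ContinuousLinearMap.comp_apply, ← ContinuousLinearMap.comp_apply,
      ← hS.map_add _ _ hs (le_of_lt hδ), ← hS.map_add _ _ (le_of_lt hδ) hs, add_comm]
  simp [h1]

theorem IsGeneratorOf.hasDerivWithinAt (hS : IsC0Semigroup S) (hA : IsGeneratorOf A S)
    (x : A.domain) {s : ℝ} (hs : 0 ≤ s) :
    HasDerivWithinAt (fun r => S r x) (S s (A x)) (Ioi s) s := by
  rw [hasDerivWithinAt_Ioi_iff_tendsto]
  refine (((S s).continuous.tendsto _).comp (hA.tendsto x)).congr' ?_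
  refine eventually_nhdsWithin_of_forall fun δ hδ => ?_
  beta_reduce
  rw [hS.map_add _ _ hs (le_of_lt hδ)]
  simp

/-- The variation-of-constants formula. -/
theorem IsGeneratorOf.variation_of_constants [CompleteSpace X] (hS : IsC0Semigroup S)
    (hA : IsGeneratorOf A S) {y f : ℝ → X} {h : ℝ} (hh : 0 ≤ h) (hy : ContinuousOn y (Icc 0 h))
    (hf : ContinuousOn f (Icc 0 h))
    (hd : ∀ s ∈ Ico (0 : ℝ) h, ∃ hx : y s ∈ A.domain,
      HasDerivWithinAt y (A ⟨y s, hx⟩ + f s) (Ioi s) s) :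
    y h = S h (y 0) + ∫ s in (0 : ℝ)..h, S (h - s) (f s) := by
  have hc : ContinuousOn (fun s => S (h - s) (f s)) (Icc 0 h) :=
    hS.continuousOn_apply (by fun_prop) (fun s hs => sub_nonneg.2 hs.2) hf
  have key := intervalIntegral.integral_eq_sub_of_hasDeriv_right (a := 0) (b := h)
    (f := fun s => S (h - s) (y s)) (f' := fun s => S (h - s) (f s))
    (by
      rw [uIcc_of_le hh]
      exact hS.continuousOn_apply (by fun_prop) (fun s hs => sub_nonneg.2 hs.2) hy)
    (by
      intro s hs
      rw [min_eq_left hh, max_eq_right hh] at hs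
      obtain ⟨hx, hder⟩ := hd s ⟨hs.1.le, hs.2⟩
      rw [hasDerivWithinAt_Ioi_iff_tendsto] at hder ⊢
      -- The quotient of s ↦ S(h-s) y(s) is S(h-s-δ) applied to the quotient of y minus that of the
      -- orbit of y(s). The latter difference tends to f(s), and joint continuity handles the moving
      -- time.
      have h1 := hder.sub (hA.tendsto ⟨y s, hx⟩)
      rw [add_sub_cancel_left] at h1
      have hτ : Tendsto (fun δ : ℝ => h - s - δ) (𝓝[>] 0) (𝓝 (h - s)) := by
        have : Tendsto (fun δ : ℝ => h - s - δ) (𝓝 0) (𝓝 (h - s - 0)) :=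
          (continuous_const.sub continuous_id).tendsto 0
        rw [sub_zero] at this
        exact this.mono_left nhdsWithin_le_nhds
      have hτ0 : ∀ᶠ δ : ℝ in 𝓝[>] 0, 0 ≤ h - s - δ := by
        have : (0 : ℝ) < h - s := sub_pos.2 hs.2
        filter_upwards [hτ.eventually (lt_mem_nhds this)] with δ hδ using hδ.le
      refine (hS.tendsto_apply (sub_nonneg.2 hs.2.le) hτ hτ0 h1).congr' ?_
      filter_upwards [hτ0, self_mem_nhdsWithin] with δ hδ hδ0
      have h2 : S (h - s) = (S (h - s - δ)).comp (S δ) := by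
        rw [← hS.map_add _ _ hδ (le_of_lt hδ0), sub_add_cancel]
      rw [h2, ← sub_sub h s δ, ← smul_sub, map_smul, ContinuousLinearMap.comp_apply, ← map_sub]
      congr 2
      abel)
    (by
      apply ContinuousOn.intervalIntegrable
      rwa [uIcc_of_le hh])
  rw [key]
  simp [hS.map_zero]

/-- The constant function x solves y' = Ay - Ax, so variation of constants writes S(h)x - x as the
integral of S(h-s)Ax. -/
theorem IsGeneratorOf.norm_apply_sub_le [CompleteSpace X] (hS : IsC0Semigroup S)
    (hA : IsGeneratorOf A S) (x : A.domain) {h C : ℝ} (hh : 0 ≤ h)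
    (hC : ∀ s ∈ Icc 0 h, ‖S s‖ ≤ C) : ‖S h x - x‖ ≤ C * ‖A x‖ * h := by
  have h1 := hA.variation_of_constants hS (y := fun _ => (x : X)) (f := fun _ => -A x) hh
    continuousOn_const continuousOn_const fun s _ => ⟨x.2, by
      simpa using hasDerivWithinAt_const s (Ioi s) (x : X)⟩
  have h2 : S h x - x = -∫ s in (0 : ℝ)..h, S (h - s) (-A x) := by
    nth_rewrite 2 [h1]
    abel
  rw [h2, norm_neg]
  refine (intervalIntegral.norm_integral_le_of_norm_le_const (C := C * ‖A x‖) fun s hs => ?_).trans ?_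
  · rw [uIoc_of_le hh] at hs
    rw [← norm_neg (A x)]
    exact ContinuousLinearMap.le_of_opNorm_le _ (hC _ ⟨by linarith [hs.2], by linarith [hs.1]⟩) _
  · rw [sub_zero, abs_of_nonneg hh]

/-- The domain of a generator is dense. -/
theorem IsGeneratorOf.dense_domain [CompleteSpace X] (hS : IsC0Semigroup S)
    (hA : IsGeneratorOf A S) : Dense (A.domain : Set X) := by
  intro x
  set q : ℝ → X := fun s => S (max s 0) x with hq
  have hqc : Continuous q :=
    hS.continuous_apply (by fun_prop) (fun s => le_max_right _ _) continuous_const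
  have hq0 : q 0 = x := by simp [hq, hS.map_zero]
  have hderiv : ∀ t, Tendsto (fun δ : ℝ => δ⁻¹ • ∫ s in t..t + δ, q s) (𝓝[>] 0) (𝓝 (q t)) := by
    intro t
    have h1 : HasDerivAt (fun r => ∫ s in t..r, q s) (q t) t :=
      intervalIntegral.integral_hasDerivAt_right (hqc.intervalIntegrable _ _)
        hqc.stronglyMeasurable.stronglyMeasurableAtFilter hqc.continuousAt
    have h2 := hasDerivWithinAt_Ioi_iff_tendsto.1 (h1.hasDerivWithinAt (s := Ioi t))
    simpa using h2
  -- Applying S(δ) shifts the interval of integration, so the difference quotient reduces to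
  -- averages over [t, t+δ] and [0, δ].
  have hmem : ∀ t > 0, (∫ s in (0 : ℝ)..t, q s) ∈ A.domain := by
    intro t ht
    obtain ⟨hx, -⟩ := (hA (∫ s in (0 : ℝ)..t, q s) (q t - q 0)).2 (by
      refine ((hderiv t).sub (hderiv 0)).congr' ?_
      refine eventually_nhdsWithin_of_forall fun δ hδ => ?_
      have hδ' : 0 < δ := hδ
      have h1 : S δ (∫ s in (0 : ℝ)..t, q s) = ∫ s in δ..t + δ, q s := by
        rw [← ContinuousLinearMap.intervalIntegral_comp_comm _ (hqc.intervalIntegrable _ _)]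
        have : ∫ s in (0 : ℝ)..t, q (s + δ) = ∫ s in δ..t + δ, q s := by
          rw [intervalIntegral.integral_comp_add_right, zero_add]
        rw [← this]
        refine intervalIntegral.integral_congr fun s hs => ?_
        rw [uIcc_of_le ht.le] at hs
        simp only [hq]
        rw [max_eq_left hs.1, max_eq_left (add_nonneg hs.1 hδ'.le), add_comm s,
          hS.map_add _ _ hδ'.le hs.1]
        rfl
      have hi := fun a b => hqc.intervalIntegrable (μ := MeasureTheory.volume) a b
      beta_reduce
      rw [h1, ← smul_sub, zero_add]
      congr 1
      rw [← intervalIntegral.integral_add_adjacent_intervals (hi δ t) (hi t (t + δ)),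
        ← intervalIntegral.integral_add_adjacent_intervals (hi 0 δ) (hi δ t)]
      abel)
    exact hx
  refine mem_closure_of_tendsto (b := 𝓝[>] (0 : ℝ)) (f := fun t : ℝ => t⁻¹ • ∫ s in (0 : ℝ)..0 + t, q s) ?_ ?_
  · rw [← hq0]; exact hderiv 0
  · refine eventually_nhdsWithin_of_forall fun t ht => ?_
    rw [zero_add]
    exact A.domain.smul_mem _ (hmem t ht)

/-- The Volterra equation relating the semigroups of `A` and of `A + B`. -/
theorem IsGeneratorOf.volterra_of_vadd [CompleteSpace X] {V : ℝ → X →L[ℝ] X} {B : X →L[ℝ] X}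
    (hS : IsC0Semigroup S) (hA : IsGeneratorOf A S) (hV : IsC0Semigroup V)
    (hJ : IsGeneratorOf ((B : X →ₗ[ℝ] X) +ᵥ A) V) (x : A.domain) {t : ℝ} (ht : 0 ≤ t) :
    V t x = S t x + ∫ s in (0 : ℝ)..t, S (t - s) (B (V s x)) := by
  have hc : ContinuousOn (fun s => V s x) (Icc 0 t) :=
    hV.continuousOn_apply continuousOn_id (fun s hs => hs.1) continuousOn_const
  have := hA.variation_of_constants hS (y := fun s => V s x) (f := fun s => B (V s x)) ht hc
    (B.continuous.comp_continuousOn hc) fun s hs => by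
      obtain ⟨hx, h⟩ := hJ.apply_mem hV ⟨x, x.2⟩ hs.1
      refine ⟨hx, ?_⟩
      have h2 := hJ.hasDerivWithinAt hV ⟨x, x.2⟩ hs.1
      rw [← h] at h2
      convert h2 using 1
      rw [add_comm]
      rfl
  simpa [hV.map_zero] using this

/-- A bound for the perturbed semigroup on short time intervals. -/
theorem IsGeneratorOf.norm_le_of_vadd [CompleteSpace X] {V : ℝ → X →L[ℝ] X} {B : X →L[ℝ] X}
    (hS : IsC0Semigroup S) (hA : IsGeneratorOf A S) (hV : IsC0Semigroup V)
    (hJ : IsGeneratorOf ((B : X →ₗ[ℝ] X) +ᵥ A) V) {N h : ℝ} (hh : 0 ≤ h)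
    (hN : ∀ s ∈ Icc 0 h, ‖S s‖ ≤ N) (hB : N * ‖B‖ * h ≤ 1 / 2) :
    ∀ s ∈ Icc 0 h, ‖V s‖ ≤ 2 * N := by
  have hN0 : 0 ≤ N := (norm_nonneg _).trans (hN 0 ⟨le_rfl, hh⟩)
  have key : ∀ x : A.domain, ∀ s ∈ Icc 0 h, ‖V s x‖ ≤ 2 * N * ‖(x : X)‖ := by
    intro x
    -- At a maximum m of ‖V(s)x‖ the Volterra term is at most half of that maximum and is absorbed.
    -- The Volterra equation is at hand on the domain only; density gives the rest.
    have hc : ContinuousOn (fun s => ‖V s x‖) (Icc 0 h) :=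
      (hV.continuousOn_apply continuousOn_id (fun s hs => hs.1) continuousOn_const).norm
    obtain ⟨m, hm, hmax⟩ := isCompact_Icc.exists_isMaxOn ⟨0, le_rfl, hh⟩ hc
    have h1 : ‖V m x‖ ≤ N * ‖(x : X)‖ + N * ‖B‖ * ‖V m x‖ * m := by
      rw [hA.volterra_of_vadd hS hV hJ x hm.1]
      refine (norm_add_le _ _).trans (add_le_add
        (ContinuousLinearMap.le_of_opNorm_le _ (hN m hm) _) ?_)
      -- The first rewriting also expanded ‖V m x‖ on the right; this restores it.
      rw [← hA.volterra_of_vadd hS hV hJ x hm.1]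
      refine (intervalIntegral.norm_integral_le_of_norm_le_const
        (C := N * ‖B‖ * ‖V m x‖) fun s hs => ?_).trans ?_
      · rw [uIoc_of_le hm.1] at hs
        have hs' : s ∈ Icc 0 h := ⟨hs.1.le, hs.2.trans hm.2⟩
        rw [mul_assoc]
        refine ContinuousLinearMap.le_of_opNorm_le_of_le _
          (hN _ ⟨by linarith [hs.2], by linarith [hs.1, hm.2]⟩) ?_
        exact ContinuousLinearMap.le_of_opNorm_le_of_le _ le_rfl (hmax hs')
      · rw [sub_zero, abs_of_nonneg hm.1]
    have h2 : N * ‖B‖ * ‖V m x‖ * m ≤ 1 / 2 * ‖V m x‖ := by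
      calc N * ‖B‖ * ‖V m x‖ * m ≤ N * ‖B‖ * ‖V m x‖ * h := by
            gcongr; exact hm.2
        _ = (N * ‖B‖ * h) * ‖V m x‖ := by ring
        _ ≤ _ := by gcongr
    intro s hs
    have h3 : ‖V s x‖ ≤ ‖V m x‖ := hmax hs
    linarith
  intro s hs
  refine ContinuousLinearMap.opNorm_le_bound _ (by positivity) fun x => ?_
  have hclosed : IsClosed {x : X | ‖V s x‖ ≤ 2 * N * ‖x‖} :=
    isClosed_le (by fun_prop) (by fun_prop)
  exact closure_minimal (fun x hx => key ⟨x, hx⟩ s hs) hclosed (hA.dense_domain hS x)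

end SemigroupTheory

/-! ### Bounded perturbations of generators through Volterra equations. -/

section Perturbation

variable {X : Type*} [NormedAddCommGroup X] [NormedSpace ℝ X]

/-- Rescaling a semigroup by an exponential. -/
theorem IsC0Semigroup.exp_smul {S : ℝ → X →L[ℝ] X} (hS : IsC0Semigroup S) (a : ℝ) :
    IsC0Semigroup fun t => Real.exp (a * t) • S t where
  map_zero := by simp [hS.map_zero]
  map_add s t hs ht := by
    rw [hS.map_add s t hs ht, mul_add, Real.exp_add]
    ext x
    simp [smul_smul, mul_comm]
  tendsto_zero x := by
    have h1 : Tendsto (fun t : ℝ => Real.exp (a * t)) (𝓝[>] 0) (𝓝 (Real.exp (a * 0))) :=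
      ((by fun_prop : Continuous fun t : ℝ => Real.exp (a * t)).tendsto 0).mono_left
        nhdsWithin_le_nhds
    have := h1.smul (hS.tendsto_zero x)
    simpa using this

variable {W : ℝ → X →L[ℝ] X} {M μ : ℝ}

/-- The Volterra integral `∫_0^t W(t-s) B f(s) ds`, extended to a constant for `t ≤ 0`. -/
def volterraIntegral (W : ℝ → X →L[ℝ] X) (B : X →L[ℝ] X) (f : ℝ → X) (t : ℝ) : X :=
  ∫ s in (0 : ℝ)..max t 0, W (max (max t 0 - s) 0) (B (f s))

theorem volterraIntegral_of_nonneg (B : X →L[ℝ] X) (f : ℝ → X) {t : ℝ} (ht : 0 ≤ t) :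
    volterraIntegral W B f t = ∫ s in (0 : ℝ)..t, W (t - s) (B (f s)) := by
  rw [volterraIntegral, max_eq_left ht]
  refine intervalIntegral.integral_congr fun s hs => ?_
  rw [uIcc_of_le ht] at hs
  rw [max_eq_left (sub_nonneg.2 hs.2)]

/-- The constant is independent of t because ∫_0^∞ M e^{-μτ} dτ = M/μ; this makes the Volterra
operator bounded on functions on the whole line. -/
theorem norm_volterraIntegral_le (hM : 0 ≤ M) (hμ : 0 < μ)
    (hb : ∀ t, 0 ≤ t → ‖W t‖ ≤ M * Real.exp (-μ * t)) (B : X →L[ℝ] X) {f : ℝ → X} {C : ℝ}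
    (hC : ∀ t, ‖f t‖ ≤ C) (t : ℝ) : ‖volterraIntegral W B f t‖ ≤ M * ‖B‖ / μ * C := by
  have hC0 : 0 ≤ C := (norm_nonneg _).trans (hC 0)
  set T := max t 0
  have hT : 0 ≤ T := le_max_right _ _
  have hd : ∀ s, HasDerivAt (fun s => M * ‖B‖ * C / μ * Real.exp (-μ * (T - s)))
      (M * ‖B‖ * C * Real.exp (-μ * (T - s))) s := by
    intro s
    have h1 : HasDerivAt (fun s => -μ * (T - s)) μ s := by
      have := ((hasDerivAt_id s).const_sub T).const_mul (-μ)
      simpa using this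
    have := h1.exp.const_mul (M * ‖B‖ * C / μ)
    refine this.congr_deriv ?_
    field_simp
  have hcont : Continuous fun s => M * ‖B‖ * C * Real.exp (-μ * (T - s)) := by fun_prop
  have h2 := intervalIntegral.integral_eq_sub_of_hasDerivAt (fun s _ => hd s)
    (hcont.intervalIntegrable 0 T)
  have h3 : ‖volterraIntegral W B f t‖ ≤ ∫ s in (0 : ℝ)..T, M * ‖B‖ * C * Real.exp (-μ * (T - s)) := by
    refine intervalIntegral.norm_integral_le_of_norm_le hT (.of_forall fun s hs => ?_)
      (hcont.intervalIntegrable 0 T)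
    rw [max_eq_left (sub_nonneg.2 hs.2)]
    calc _ ≤ (M * Real.exp (-μ * (T - s))) * (‖B‖ * C) :=
          ContinuousLinearMap.le_of_opNorm_le_of_le _ (hb _ (sub_nonneg.2 hs.2))
            (ContinuousLinearMap.le_of_opNorm_le_of_le _ le_rfl (hC s))
      _ = _ := by ring
  refine h3.trans ?_
  rw [h2]
  have h4 : 0 ≤ M * ‖B‖ * C / μ * Real.exp (-μ * (T - 0)) := by positivity
  simp only [sub_self, mul_zero, Real.exp_zero, mul_one] at h4 ⊢
  calc _ ≤ M * ‖B‖ * C / μ := by linarith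
    _ = _ := by ring

variable [CompleteSpace X]

/-- Divided by δ, the Volterra integral tends to Bx for every x. The difference quotients of V and S
therefore converge for the same x, which identifies the domain along with the operator. -/
theorem IsGeneratorOf.vadd_of_volterra {S V : ℝ → X →L[ℝ] X} {A : X →ₗ.[ℝ] X} {B : X →L[ℝ] X}
    (hS : IsC0Semigroup S) (hA : IsGeneratorOf A S) (hV : IsC0Semigroup V)
    (h : ∀ t, 0 ≤ t → ∀ x, V t x = S t x + ∫ s in (0 : ℝ)..t, S (t - s) (B (V s x))) :
    IsGeneratorOf ((B : X →ₗ[ℝ] X) +ᵥ A) V := by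
  intro x y
  have hlim : Tendsto (fun δ : ℝ => δ⁻¹ • ∫ s in (0 : ℝ)..δ, S (δ - s) (B (V s x)))
      (𝓝[>] 0) (𝓝 (B x)) := by
    -- The substitution s = δσ turns the average into an integral over [0, 1] depending continuously
    -- on δ up to δ = 0; the truncations keep all times nonnegative.
    have hc : Continuous (fun p : ℝ × ℝ => S (max (p.1 - p.1 * p.2) 0) (B (V (max (p.1 * p.2) 0) x))) :=
      hS.continuous_apply (by fun_prop) (fun _ => le_max_right _ _)
        (B.continuous.comp (hV.continuous_apply (by fun_prop) (fun _ => le_max_right _ _)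
          continuous_const))
    have hc2 := intervalIntegral.continuous_parametric_intervalIntegral_of_continuous'
      (μ := MeasureTheory.volume)
      (f := fun δ σ : ℝ => S (max (δ - δ * σ) 0) (B (V (max (δ * σ) 0) x))) hc 0 1
    have h0 := (hc2.tendsto 0).mono_left (nhdsWithin_le_nhds (s := Ioi 0))
    simp only [zero_mul, sub_zero, max_self, hS.map_zero, hV.map_zero,
      ContinuousLinearMap.id_apply, intervalIntegral.integral_const, one_smul] at h0
    refine h0.congr' (eventually_nhdsWithin_of_forall fun δ hδ => ?_)
    have hδ' : 0 < δ := hδ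
    have h1 := intervalIntegral.smul_integral_comp_mul_left (a := 0) (b := 1)
      (fun s => S (δ - s) (B (V s x))) δ
    rw [mul_zero, mul_one] at h1
    beta_reduce
    rw [← h1, inv_smul_smul₀ hδ'.ne']
    refine intervalIntegral.integral_congr fun σ hσ => ?_
    rw [uIcc_of_le zero_le_one] at hσ
    rw [max_eq_left (mul_nonneg hδ'.le hσ.1), max_eq_left]
    nlinarith [hσ.2]
  have heq : ∀ δ ∈ Ioi (0 : ℝ), δ⁻¹ • (V δ x - x) =
      δ⁻¹ • (S δ x - x) + δ⁻¹ • ∫ s in (0 : ℝ)..δ, S (δ - s) (B (V s x)) := by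
    intro δ hδ
    rw [h δ (le_of_lt hδ), ← smul_add]
    congr 1
    abel
  have h1 : Tendsto (fun δ : ℝ => δ⁻¹ • (V δ x - x)) (𝓝[>] 0) (𝓝 y) ↔
      Tendsto (fun δ : ℝ => δ⁻¹ • (S δ x - x)) (𝓝[>] 0) (𝓝 (y - B x)) := by
    constructor
    · intro hy
      refine (hy.sub hlim).congr' (eventually_nhdsWithin_of_forall fun δ hδ => ?_)
      rw [heq δ hδ, add_sub_cancel_right]
    · intro hy
      have h2 := hy.add hlim
      rw [sub_add_cancel] at h2
      exact h2.congr' (eventually_nhdsWithin_of_forall fun δ hδ => (heq δ hδ).symm)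
  rw [h1, ← hA]
  constructor
  · rintro ⟨hx, hy⟩
    refine ⟨hx, ?_⟩
    rw [← hy]
    exact (add_sub_cancel_left (B x) (A ⟨x, hx⟩)).symm
  · rintro ⟨hx, hy⟩
    refine ⟨hx, ?_⟩
    change B x + A ⟨x, hx⟩ = y
    rw [hy, add_sub_cancel]

theorem continuous_volterra_integrand (hW : IsC0Semigroup W) (B : X →L[ℝ] X) {f : ℝ → X}
    (hf : Continuous f) :
    Continuous fun p : ℝ × ℝ => W (max (max p.1 0 - p.2) 0) (B (f p.2)) :=
  hW.continuous_apply (by fun_prop) (fun _ => le_max_right _ _) (by fun_prop)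

theorem continuous_volterraIntegral (hW : IsC0Semigroup W) (B : X →L[ℝ] X) {f : ℝ → X}
    (hf : Continuous f) : Continuous (volterraIntegral W B f) :=
  intervalIntegral.continuous_parametric_intervalIntegral_of_continuous
    (continuous_volterra_integrand hW B hf) (by fun_prop)

theorem intervalIntegrable_volterra (hW : IsC0Semigroup W) (B : X →L[ℝ] X) {f : ℝ → X}
    (hf : Continuous f) (t a b : ℝ) :
    IntervalIntegrable (fun s => W (max (max t 0 - s) 0) (B (f s))) MeasureTheory.volume a b :=
  ((continuous_volterra_integrand hW B hf).comp (Continuous.prodMk_right t)).intervalIntegrable _ _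

open BoundedContinuousFunction in
/-- The Volterra operator on bounded continuous functions. -/
def volterraOp (hW : IsC0Semigroup W) (hM : 0 ≤ M) (hμ : 0 < μ)
    (hb : ∀ t, 0 ≤ t → ‖W t‖ ≤ M * Real.exp (-μ * t)) (B : X →L[ℝ] X) :
    (ℝ →ᵇ X) →L[ℝ] (ℝ →ᵇ X) :=
  LinearMap.mkContinuous
    { toFun := fun f => .ofNormedAddCommGroup (volterraIntegral W B f)
        (continuous_volterraIntegral hW B f.continuous) (M * ‖B‖ / μ * ‖f‖)
        (norm_volterraIntegral_le hM hμ hb B f.norm_coe_le_norm)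
      map_add' := fun f g => by
        ext t
        simp only [volterraIntegral, BoundedContinuousFunction.coe_ofNormedAddCommGroup,
          BoundedContinuousFunction.coe_add, Pi.add_apply, map_add]
        exact intervalIntegral.integral_add (intervalIntegrable_volterra hW B f.continuous _ _ _)
          (intervalIntegrable_volterra hW B g.continuous _ _ _)
      map_smul' := fun c f => by
        ext t
        simp [volterraIntegral] }
    (M * ‖B‖ / μ) fun f => by
      exact BoundedContinuousFunction.norm_ofNormedAddCommGroup_le _ (by positivity)
        (norm_volterraIntegral_le hM hμ hb B f.norm_coe_le_norm)

open BoundedContinuousFunction in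
theorem volterraOp_apply (hW : IsC0Semigroup W) (hM : 0 ≤ M) (hμ : 0 < μ)
    (hb : ∀ t, 0 ≤ t → ‖W t‖ ≤ M * Real.exp (-μ * t)) (B : X →L[ℝ] X) (f : ℝ →ᵇ X) (t : ℝ) :
    volterraOp hW hM hμ hb B f t = volterraIntegral W B f t := rfl

open BoundedContinuousFunction in
/-- The orbit map `x ↦ (t ↦ W(t) x)` of a bounded semigroup, extended by `x` to `t ≤ 0`. -/
def orbitMap (hW : IsC0Semigroup W) (hM : 0 ≤ M) (hb : ∀ t, 0 ≤ t → ‖W t‖ ≤ M) :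
    X →L[ℝ] (ℝ →ᵇ X) :=
  LinearMap.mkContinuous
    { toFun := fun x => .ofNormedAddCommGroup (fun t => W (max t 0) x)
        (hW.continuous_apply (by fun_prop) (fun _ => le_max_right _ _) continuous_const) (M * ‖x‖)
        (fun t => ContinuousLinearMap.le_of_opNorm_le _ (hb _ (le_max_right _ _)) x)
      map_add' := fun x y => by ext t; simp
      map_smul' := fun c x => by ext t; simp }
    M fun x => BoundedContinuousFunction.norm_ofNormedAddCommGroup_le _ (by positivity)
      fun t => ContinuousLinearMap.le_of_opNorm_le _ (hb _ (le_max_right _ _)) x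

open BoundedContinuousFunction in
theorem orbitMap_apply (hW : IsC0Semigroup W) (hM : 0 ≤ M) (hb : ∀ t, 0 ≤ t → ‖W t‖ ≤ M)
    (x : X) (t : ℝ) : orbitMap hW hM hb x t = W (max t 0) x := rfl

/-- A small perturbation of an exponentially decaying semigroup. -/
theorem exists_volterra_semigroup (hW : IsC0Semigroup W) (hM : 0 ≤ M)
    (hb : ∀ t, 0 ≤ t → ‖W t‖ ≤ M * Real.exp (-μ * t)) {B : X →L[ℝ] X} (hB : M * ‖B‖ < μ) :
    ∃ V : ℝ → X →L[ℝ] X, IsC0Semigroup V ∧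
      ∀ t, 0 ≤ t → ∀ x, V t x = W t x + ∫ s in (0 : ℝ)..t, W (t - s) (B (V s x)) := by
  have hμ : 0 < μ := lt_of_le_of_lt (by positivity) hB
  have hb' : ∀ t, 0 ≤ t → ‖W t‖ ≤ M := fun t ht => (hb t ht).trans <|
    mul_le_of_le_one_right hM (Real.exp_le_one_iff.2 (by nlinarith))
  set k := volterraOp hW hM hμ hb B with hk
  set ι := orbitMap hW hM hb' with hι
  -- By the Neumann series, f - k f = W(·)x has exactly one bounded continuous solution. Existence
  -- defines V, uniqueness gives the semigroup law.
  have hk1 : ‖k‖ < 1 := by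
    refine (LinearMap.mkContinuous_norm_le _ (by positivity) _).trans_lt ?_
    rwa [div_lt_one hμ]
  obtain ⟨U, hU⟩ := isUnit_one_sub_of_norm_lt_one hk1
  set R : BoundedContinuousFunction ℝ X →L[ℝ] BoundedContinuousFunction ℝ X := ↑U⁻¹ with hR
  have hUR : ∀ f, R f - k (R f) = f := by
    intro f
    have : (1 - k) * R = 1 := by rw [← hU]; exact U.mul_inv
    simpa using congrArg (fun T => T f) this
  have hinj : ∀ f g, f - k f = g - k g → f = g := by
    intro f g hfg
    have h1 : R * (1 - k) = 1 := by rw [← hU]; exact U.inv_mul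
    have h2 : ∀ f, R (f - k f) = f := fun f => by simpa using congrArg (fun T => T f) h1
    rw [← h2 f, hfg, h2]
  set V : ℝ → X →L[ℝ] X := fun t =>
    (BoundedContinuousFunction.evalCLM ℝ t).comp (R.comp ι) with hV
  have hvol : ∀ t, 0 ≤ t → ∀ x, V t x = W t x + ∫ s in (0 : ℝ)..t, W (t - s) (B (V s x)) := by
    intro t ht x
    have h1 := congrArg (fun f : BoundedContinuousFunction ℝ X => f t) (hUR (ι x))
    simp only [BoundedContinuousFunction.coe_sub, Pi.sub_apply] at h1
    rw [hk, volterraOp_apply, volterraIntegral_of_nonneg _ _ ht, hι, orbitMap_apply, ← hι,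
      max_eq_left ht] at h1
    exact sub_eq_iff_eq_add.1 h1
  have hV0 : V 0 = ContinuousLinearMap.id ℝ X := by
    ext x
    rw [hvol 0 le_rfl]
    simp [hW.map_zero]
  have hVc : ∀ x, Continuous fun t => V t x := fun x => (R (ι x)).continuous
  refine ⟨V, ⟨hV0, ?_, fun x => ?_⟩, hvol⟩
  · intro s t hs ht
    rw [add_comm s t]
    ext x
    -- the shifted orbit of `x` and the orbit of `V t x` solve the same Volterra equation
    set f : BoundedContinuousFunction ℝ X := .ofNormedAddCommGroup (fun r => V (t + max r 0) x)
      ((hVc x).comp (by fun_prop)) ‖R (ι x)‖ (fun r => (R (ι x)).norm_coe_le_norm _) with hf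
    have hfa : ∀ r, f r = V (t + max r 0) x := fun _ => rfl
    have hfg : f = R (ι (V t x)) := by
      refine hinj _ _ ?_
      rw [hUR]
      ext r
      have hr : 0 ≤ max r 0 := le_max_right _ _
      rw [BoundedContinuousFunction.coe_sub, Pi.sub_apply, hk, volterraOp_apply,
        orbitMap_apply, hfa]
      rw [volterraIntegral, intervalIntegral.integral_congr (g := fun s =>
        W (max r 0 - s) (B (V (t + s) x))) (by
          intro s hs
          rw [uIcc_of_le hr] at hs
          beta_reduce
          rw [max_eq_left (sub_nonneg.2 hs.2), hfa, max_eq_left hs.1])]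
      set ρ := max r 0
      have hci : ∀ a b, a ≤ b → b ≤ t + ρ → IntervalIntegrable
          (fun s => W (t + ρ - s) (B (V s x))) MeasureTheory.volume a b := by
        intro a b hab hbt
        refine ContinuousOn.intervalIntegrable (hW.continuousOn_apply (by fun_prop) ?_ ?_)
        · intro s hs
          rw [uIcc_of_le hab] at hs
          linarith [hs.2]
        · exact (B.continuous.comp (hVc x)).continuousOn
      have h1 : ∫ s in (0 : ℝ)..ρ, W (ρ - s) (B (V (t + s) x)) =
          ∫ s in t..t + ρ, W (t + ρ - s) (B (V s x)) := by
        have := intervalIntegral.integral_comp_add_left (a := 0) (b := ρ)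
          (fun s => W (t + ρ - s) (B (V s x))) t
        simpa using this
      have h2 : W ρ (∫ s in (0 : ℝ)..t, W (t - s) (B (V s x))) =
          ∫ s in (0 : ℝ)..t, W (t + ρ - s) (B (V s x)) := by
        rw [← ContinuousLinearMap.intervalIntegral_comp_comm]
        · refine intervalIntegral.integral_congr fun s hs => ?_
          rw [uIcc_of_le ht] at hs
          rw [← ContinuousLinearMap.comp_apply, ← hW.map_add _ _ hr (sub_nonneg.2 hs.2)]
          congr 2
          ring
        · refine ContinuousOn.intervalIntegrable (hW.continuousOn_apply (by fun_prop) ?_ ?_)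
          · intro s hs
            rw [uIcc_of_le ht] at hs
            linarith [hs.2]
          · exact (B.continuous.comp (hVc x)).continuousOn
      -- The Volterra equation at t + ρ, with its integral split at t, differs from W(ρ) applied to
      -- the equation at t by exactly the integral over [t, t+ρ].
      rw [h1, hvol (t + ρ) (by linarith), hvol t ht, map_add, h2,
        ← intervalIntegral.integral_add_adjacent_intervals (hci 0 t ht (by linarith))
          (hci t (t + ρ) (by linarith) le_rfl),
        ← ContinuousLinearMap.comp_apply, ← hW.map_add _ _ hr ht, add_comm ρ t]
      abel
    have h1 := hfa s
    rw [hfg, max_eq_left hs] at h1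
    rw [← h1]
    rfl
  · have h1 := ((hVc x).tendsto 0).mono_left (nhdsWithin_le_nhds (s := Ioi 0))
    simpa [hV0] using h1

/-- The bounded perturbation theorem. -/
theorem GeneratesC0Semigroup.vadd {A : X →ₗ.[ℝ] X} (hA : GeneratesC0Semigroup A) (B : X →L[ℝ] X) :
    GeneratesC0Semigroup ((B : X →ₗ[ℝ] X) +ᵥ A) := by
  obtain ⟨S, hS, hAS⟩ := hA
  obtain ⟨M, ω, hb⟩ := hS.exists_exp_bound
  have hM : 0 ≤ M := by
    have := (norm_nonneg _).trans (hb 0 le_rfl)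
    simpa using this
  -- The rescaled semigroup decays at rate M‖B‖ + 1, just above the threshold M‖B‖; the rescaling is
  -- undone at the end.
  set l := ω + (M * ‖B‖ + 1) with hl
  obtain ⟨V, hV, hvol⟩ := exists_volterra_semigroup (hS.exp_smul (-l)) hM (μ := M * ‖B‖ + 1)
    (fun t ht => by
      rw [norm_smul, Real.norm_eq_abs, abs_of_pos (Real.exp_pos _)]
      calc Real.exp (-l * t) * ‖S t‖ ≤ Real.exp (-l * t) * (M * Real.exp (ω * t)) := by
            gcongr; exact hb t ht
        _ = M * (Real.exp (-l * t) * Real.exp (ω * t)) := by ring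
        _ = _ := by rw [← Real.exp_add, hl]; ring_nf) (lt_add_one (M * ‖B‖))
  refine ⟨_, hV.exp_smul l, IsGeneratorOf.vadd_of_volterra hS hAS (hV.exp_smul l) ?_⟩
  intro t ht x
  rw [_root_.smul_apply, hvol t ht, smul_add, _root_.smul_apply, smul_smul,
    ← Real.exp_add, neg_mul, add_neg_cancel, Real.exp_zero, one_smul,
    ← intervalIntegral.integral_smul]
  congr 1
  refine intervalIntegral.integral_congr fun s hs => ?_
  simp only [_root_.smul_apply, map_smul, smul_smul, ← Real.exp_add]
  congr 2
  ring

end Perturbation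

/-! ### The φ-functions as functionals, and the passage from matrices to generators. -/

section PhiFunctional

variable {X : Type*} [NormedAddCommGroup X] [NormedSpace ℝ X]

/-- The functional `f ↦ ∫_0^1 θ^{k-1}/(k-1)! f((1-θ)σ) dθ` (`f ↦ f(σ)` for `k = 0`), which maps
`s ↦ e^{sZ}` to `φ_k(σZ)`. -/
def phiFunctional (f : ℝ → X) (σ : ℝ) : ℕ → X
  | 0 => f σ
  | k + 1 => ∫ θ in (0 : ℝ)..1, (θ ^ k / (k ! : ℝ)) • f ((1 - θ) * σ)

/-- The linear combination of the functionals `phiFunctional` with the coefficients of `b`. -/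
def PhiCombination.functional (b : PhiCombination) (f : ℝ → X) : X :=
  Finsupp.sum b fun p r => r • phiFunctional f p.2 p.1

theorem phiOp_mul_eq_phiFunctional (A : X →ₗ.[ℝ] X) (σ h : ℝ) (k : ℕ) (x : X) :
    phiOp A (σ * h) k x = phiFunctional (fun s => expSemigroup A (s * h) x) σ k := by
  cases k with
  | zero => rfl
  | succ k => simp only [phiOp, phiFunctional, mul_assoc]

theorem PhiCombination.onGenerator_eq_functional (b : PhiCombination) (A : X →ₗ.[ℝ] X) (h : ℝ)
    (x : X) : b.onGenerator A h x = b.functional fun s => expSemigroup A (s * h) x := by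
  simp only [PhiCombination.onGenerator, PhiCombination.functional, phiOp_mul_eq_phiFunctional]

theorem one_sub_mul_mem_Icc {σ R θ : ℝ} (hσ : 0 ≤ σ) (hR : σ ≤ R) (hθ : θ ∈ Icc (0 : ℝ) 1) :
    (1 - θ) * σ ∈ Icc 0 R :=
  ⟨mul_nonneg (by linarith [hθ.2]) hσ, by nlinarith [hθ.1]⟩

theorem intervalIntegrable_phi_integrand {f : ℝ → X} {R : ℝ} (hf : ContinuousOn f (Icc 0 R))
    {σ : ℝ} (hσ : 0 ≤ σ) (hR : σ ≤ R) (k : ℕ) :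
    IntervalIntegrable (fun θ : ℝ => (θ ^ k / (k ! : ℝ)) • f ((1 - θ) * σ))
      MeasureTheory.volume 0 1 := by
  refine ContinuousOn.intervalIntegrable ?_
  rw [uIcc_of_le zero_le_one]
  exact ContinuousOn.smul (by fun_prop)
    (hf.comp (by fun_prop) fun θ hθ => one_sub_mul_mem_Icc hσ hR hθ)

theorem phiFunctional_congr {f g : ℝ → X} {σ : ℝ} (hσ : 0 ≤ σ) (h : EqOn f g (Icc 0 σ)) (k : ℕ) :
    phiFunctional f σ k = phiFunctional g σ k := by
  cases k with
  | zero => exact h ⟨hσ, le_rfl⟩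
  | succ k =>
    refine intervalIntegral.integral_congr fun θ hθ => ?_
    rw [uIcc_of_le zero_le_one] at hθ
    rw [h (one_sub_mul_mem_Icc hσ le_rfl hθ)]

theorem ContinuousLinearMap.map_phiFunctional [CompleteSpace X] {Y : Type*} [NormedAddCommGroup Y]
    [NormedSpace ℝ Y] [CompleteSpace Y] (l : X →L[ℝ] Y) {f : ℝ → X} {σ : ℝ} (hσ : 0 ≤ σ)
    (hf : ContinuousOn f (Icc 0 σ)) (k : ℕ) :
    l (phiFunctional f σ k) = phiFunctional (fun s => l (f s)) σ k := by
  cases k with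
  | zero => rfl
  | succ k =>
    simp only [phiFunctional]
    rw [← l.intervalIntegral_comp_comm (intervalIntegrable_phi_integrand hf hσ le_rfl k)]
    simp only [map_smul]

theorem norm_phi_weight_le {θ : ℝ} (hθ : θ ∈ Icc (0 : ℝ) 1) (k : ℕ) :
    ‖θ ^ k / (k ! : ℝ)‖ ≤ 1 := by
  have h1 : θ ^ k ≤ 1 := pow_le_one₀ hθ.1 hθ.2
  have h2 : (1 : ℝ) ≤ k ! := by exact_mod_cast Nat.one_le_iff_ne_zero.2 (Nat.factorial_ne_zero k)
  have h3 : 0 ≤ θ ^ k := pow_nonneg hθ.1 k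
  rw [Real.norm_of_nonneg (by positivity)]
  exact (div_le_one (by positivity)).2 (h1.trans h2)

theorem norm_phiFunctional_le {f : ℝ → X} {σ C : ℝ} (hσ : 0 ≤ σ)
    (hC : ∀ s ∈ Icc 0 σ, ‖f s‖ ≤ C) (k : ℕ) : ‖phiFunctional f σ k‖ ≤ C := by
  cases k with
  | zero => exact hC σ ⟨hσ, le_rfl⟩
  | succ k =>
    have := intervalIntegral.norm_integral_le_of_norm_le_const (a := 0) (b := 1) (C := C)
      (f := fun θ : ℝ => (θ ^ k / (k ! : ℝ)) • f ((1 - θ) * σ)) fun θ hθ => by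
        rw [uIoc_of_le zero_le_one] at hθ
        have hθ' : θ ∈ Icc (0 : ℝ) 1 := ⟨hθ.1.le, hθ.2⟩
        rw [norm_smul]
        calc _ ≤ 1 * C := mul_le_mul (norm_phi_weight_le hθ' k)
              (hC _ (one_sub_mul_mem_Icc hσ le_rfl hθ')) (norm_nonneg _) zero_le_one
          _ = C := one_mul C
    rwa [sub_zero, abs_one, mul_one] at this

/-- `phiFunctional` as a continuous linear functional on `C([0, R])`. -/
def phiCLM (R : ℝ) (hR : 0 ≤ R) (k : ℕ) (σ : Icc (0 : ℝ) R) : C(Icc (0 : ℝ) R, ℝ) →L[ℝ] ℝ :=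
  LinearMap.mkContinuous
    { toFun := fun f => phiFunctional (IccExtend hR f) σ k
      map_add' := fun f g => by
        cases k with
        | zero => simp [phiFunctional, IccExtend]
        | succ k =>
          simp only [phiFunctional]
          rw [← intervalIntegral.integral_add
            (intervalIntegrable_phi_integrand (by fun_prop) σ.2.1 σ.2.2 k)
            (intervalIntegrable_phi_integrand (by fun_prop) σ.2.1 σ.2.2 k)]
          simp [IccExtend, mul_add]
      map_smul' := fun c f => by
        cases k with
        | zero => simp [phiFunctional, IccExtend]
        | succ k =>
          simp only [phiFunctional, RingHom.id_apply]
          rw [← intervalIntegral.integral_smul]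
          simp only [IccExtend, Function.comp_apply, ContinuousMap.smul_apply, smul_eq_mul]
          congr 1
          ext θ
          ring }
    1 fun f => by
      rw [one_mul]
      exact norm_phiFunctional_le σ.2.1 (fun s _ => f.norm_coe_le_norm _) k

theorem phiCLM_apply (R : ℝ) (hR : 0 ≤ R) (k : ℕ) (σ : Icc (0 : ℝ) R) {f : ℝ → ℝ}
    (hf : ContinuousOn f (Icc 0 R)) :
    phiCLM R hR k σ ⟨(Icc 0 R).domRestrict f, hf.domRestrict⟩ = phiFunctional f σ k := by
  refine phiFunctional_congr σ.2.1 (fun s hs => ?_) k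
  rw [IccExtend_of_mem _ _ ⟨hs.1, hs.2.trans σ.2.2⟩]
  rfl

/-- Two continuous functionals on `C([0, R])` agreeing on all `e^{ns}` are equal. -/
theorem eq_of_forall_exp {R : ℝ} {Λ Λ' : C(Icc (0 : ℝ) R, ℝ) →L[ℝ] ℝ}
    (h : ∀ n : ℕ, Λ ⟨fun s => Real.exp (n * s), by fun_prop⟩ =
      Λ' ⟨fun s => Real.exp (n * s), by fun_prop⟩) : Λ = Λ' := by
  set e : C(Icc (0 : ℝ) R, ℝ) := ⟨fun s => Real.exp s, by fun_prop⟩ with he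
  have hpow : ∀ n : ℕ, e ^ n = ⟨fun s => Real.exp (n * s), by fun_prop⟩ := by
    intro n
    ext s
    simp [he, Real.exp_nat_mul]
  -- Stone–Weierstrass: e^s alone separates points, and polynomials in it are combinations of the
  -- e^{ns}.
  have htop : (Algebra.adjoin ℝ {e}).topologicalClosure = ⊤ := by
    refine ContinuousMap.subalgebra_topologicalClosure_eq_top_of_separatesPoints _ ?_
    intro x y hxy
    refine ⟨e, ⟨e, Algebra.self_mem_adjoin_singleton ℝ e, rfl⟩, fun hexp => hxy ?_⟩
    exact Subtype.ext (Real.exp_injective hexp)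
  have hdense : Dense ((Algebra.adjoin ℝ {e} : Subalgebra ℝ C(Icc (0 : ℝ) R, ℝ)) :
      Set C(Icc (0 : ℝ) R, ℝ)) := by
    rw [dense_iff_closure_eq, ← Subalgebra.topologicalClosure_coe, htop]
    rfl
  have heq : EqOn Λ Λ' (Algebra.adjoin ℝ {e} : Subalgebra ℝ C(Icc (0 : ℝ) R, ℝ)) := by
    intro f hf
    rw [SetLike.mem_coe, Algebra.adjoin_singleton_eq_range_aeval] at hf
    obtain ⟨p, rfl⟩ := hf
    have : ∀ n : ℕ, Λ (e ^ n) = Λ' (e ^ n) := fun n => by rw [hpow, h]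
    simp [Polynomial.aeval_eq_sum_range, this]
  exact ContinuousLinearMap.ext fun f =>
    congrFun (Λ.continuous.ext_on hdense Λ'.continuous heq) f

/-- On C([0, R]) with R beyond all nodes, the functional is continuous and vanishes on a dense
subspace, hence everywhere. Vector-valued f are reduced to scalar ones by testing with the dual
space. -/
theorem PhiCombination.functional_eq_zero [CompleteSpace X] {b : PhiCombination}
    (hb : ∀ n : ℕ, b.functional (fun s => Real.exp (n * s)) = 0) {f : ℝ → X}
    (hf : ContinuousOn f (Ici 0)) : b.functional f = 0 := by
  -- The nodes are nonnegative, so their sum bounds each of them.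
  set R : ℝ := ∑ p ∈ b.support, (p.2 : ℝ) with hR
  have hR0 : 0 ≤ R := Finset.sum_nonneg fun p _ => p.2.2
  have hmem : ∀ p ∈ b.support, (p.2 : ℝ) ∈ Icc 0 R := fun p hp =>
    ⟨p.2.2, Finset.single_le_sum (f := fun p : ℕ × ℝ≥0 => (p.2 : ℝ)) (fun p _ => p.2.2) hp⟩
  set Λ : C(Icc (0 : ℝ) R, ℝ) →L[ℝ] ℝ := ∑ p ∈ b.support.attach,
    b p.1 • phiCLM R hR0 p.1.1 ⟨p.1.2, hmem p.1 p.2⟩ with hΛ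
  have hΛa : ∀ {q : ℝ → ℝ} (hq : ContinuousOn q (Icc 0 R)),
      Λ ⟨(Icc 0 R).domRestrict q, hq.domRestrict⟩ = b.functional q := by
    intro q hq
    simp only [hΛ, _root_.sum_apply, _root_.smul_apply, phiCLM_apply _ _ _ _ hq]
    rw [PhiCombination.functional, Finsupp.sum, Finset.sum_attach b.support
      (fun p => b p • phiFunctional q p.2 p.1)]
  have hΛ0 : Λ = 0 := eq_of_forall_exp fun n => by
    rw [_root_.zero_apply]
    exact (hΛa (q := fun s => Real.exp (n * s)) (by fun_prop)).trans (hb n)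
  have hIcc : ∀ r : ℝ, Icc 0 r ⊆ Ici 0 := fun r s hs => hs.1
  refine SeparatingDual.eq_zero_of_forall_dual_eq_zero (R := ℝ) fun l => ?_
  have h1 : ContinuousOn (fun s => l (f s)) (Icc 0 R) :=
    l.continuous.comp_continuousOn (hf.mono (hIcc R))
  have h2 := hΛa h1
  rw [hΛ0, _root_.zero_apply] at h2
  rw [h2, PhiCombination.functional, PhiCombination.functional, Finsupp.sum, Finsupp.sum, map_sum]
  refine Finset.sum_congr rfl fun p hp => ?_
  rw [map_smul, l.map_phiFunctional (NNReal.coe_nonneg p.2) (hf.mono (hIcc _))]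

theorem PhiCombination.functional_sub (b b' : PhiCombination) (f : ℝ → X) :
    (b - b').functional f = b.functional f - b'.functional f :=
  Finsupp.sum_sub_index fun _ _ _ => sub_smul _ _ _

theorem PhiCombination.functional_single (p : ℕ × ℝ≥0) (r : ℝ) (f : ℝ → X) :
    PhiCombination.functional (Finsupp.single p r) f = r • phiFunctional f p.2 p.1 :=
  Finsupp.sum_single_index (zero_smul _ _)

variable {𝕜 : Type*} [RCLike 𝕜]

theorem exp_smul_diagonal_apply (n s : ℝ) :
    NormedSpace.exp (s • (Matrix.diagonal fun _ => (n : 𝕜) : Matrix (Fin 1) (Fin 1) 𝕜)) 0 0 =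
      ((Real.exp (n * s) : ℝ) : 𝕜) := by
  have h1 : s • (Matrix.diagonal fun _ => (n : 𝕜) : Matrix (Fin 1) (Fin 1) 𝕜) =
      Matrix.diagonal fun _ => ((n * s : ℝ) : 𝕜) := by
    ext i j
    fin_cases i; fin_cases j
    simp [RCLike.real_smul_eq_coe_mul, mul_comm]
  rw [h1, Matrix.exp_diagonal, Matrix.diagonal_apply_eq, Pi.coe_exp, Real.exp_eq_exp_ℝ]
  exact (NormedSpace.algebraMap_exp_comm (𝕂 := ℝ) (𝔸 := 𝕜) (n * s)).symm

theorem phiMat_smul_diagonal_apply (n : ℝ) {σ : ℝ} (hσ : 0 ≤ σ) (k : ℕ) :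
    phiMat k (σ • (Matrix.diagonal fun _ => (n : 𝕜) : Matrix (Fin 1) (Fin 1) 𝕜)) 0 0 =
      ((phiFunctional (fun s => Real.exp (n * s)) σ k : ℝ) : 𝕜) := by
  have h := (RCLike.ofRealCLM (K := 𝕜)).map_phiFunctional (f := fun s => Real.exp (n * s)) hσ
    (by fun_prop) k
  rw [RCLike.ofRealCLM_apply] at h
  rw [h]
  cases k with
  | zero => exact exp_smul_diagonal_apply n σ
  | succ k =>
    simp only [phiMat, phiFunctional, Matrix.of_apply, smul_smul, exp_smul_diagonal_apply]

theorem PhiCombination.onMatrix_diagonal_apply (b : PhiCombination) (n : ℝ) :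
    b.onMatrix 1 (Matrix.diagonal fun _ => (n : 𝕜)) 0 0 =
      ((b.functional (fun s => Real.exp (n * s)) : ℝ) : 𝕜) := by
  simp only [PhiCombination.onMatrix, PhiCombination.functional, Finsupp.sum, Matrix.sum_apply,
    Matrix.smul_apply, map_sum, smul_eq_mul, RCLike.ofReal_mul,
    RCLike.real_smul_eq_coe_mul]
  refine Finset.sum_congr rfl fun p _ => ?_
  rw [phiMat_smul_diagonal_apply n (NNReal.coe_nonneg p.2)]

/-- A coefficient function is determined on generators by its values on square matrices. -/
theorem PhiCombination.onGenerator_eq_of_onMatrix_eq [CompleteSpace X] {b : PhiCombination}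
    {c : ℝ} {k : ℕ}
    (hb : ∀ (m : ℕ) (Z : Matrix (Fin m) (Fin m) 𝕜), b.onMatrix m Z = c • phiMat k Z)
    {A : X →ₗ.[ℝ] X} (hA : IsC0Semigroup (expSemigroup A)) {h : ℝ} (hh : 0 ≤ h) (x : X) :
    b.onGenerator A h x = c • phiOp A h k x := by
  set b' : PhiCombination := Finsupp.single (k, 1) c
  have h1 : ∀ n : ℕ, (b - b').functional (fun s => Real.exp (n * s)) = 0 := by
    intro n
    -- On the 1×1 matrix (n) both sides become the functionals applied to s ↦ e^{ns}.
    have h2 := congrFun (congrFun (hb 1 (Matrix.diagonal fun _ => ((n : ℝ) : 𝕜))) 0) 0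
    have h3 := phiMat_smul_diagonal_apply (𝕜 := 𝕜) (n : ℝ) zero_le_one k
    rw [one_smul] at h3
    rw [PhiCombination.onMatrix_diagonal_apply, Matrix.smul_apply, h3,
      RCLike.real_smul_eq_coe_mul, ← RCLike.ofReal_mul, RCLike.ofReal_inj] at h2
    rw [PhiCombination.functional_sub, PhiCombination.functional_single, h2]
    simp
  have h2 := PhiCombination.functional_eq_zero h1 (f := fun s => expSemigroup A (s * h) x)
    (hA.continuousOn_apply (by fun_prop) (fun s hs => mul_nonneg hs hh) continuousOn_const)
  rw [PhiCombination.functional_sub, PhiCombination.functional_single, sub_eq_zero,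
    ← PhiCombination.onGenerator_eq_functional, ← phiOp_mul_eq_phiFunctional] at h2
  simpa using h2

end PhiFunctional

/-! ### Taylor estimates for curves and for maps along segments. -/

section Taylor

variable {X Y : Type*} [NormedAddCommGroup X] [NormedSpace ℝ X] [NormedAddCommGroup Y]
  [NormedSpace ℝ Y]

theorem norm_sub_taylor_sum_le {f : ℝ → X} {a b C : ℝ} {n : ℕ}
    (hf : ContDiffOn ℝ (n + 1) f (Icc a b))
    (hC : ∀ y ∈ Icc a b, ‖iteratedDerivWithin (n + 1) f (Icc a b) y‖ ≤ C)
    {t x : ℝ} (ht : t ∈ Icc a b) (hx : x ∈ Icc t b) :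
    ‖f x - ∑ k ∈ Finset.range (n + 1),
      ((k ! : ℝ)⁻¹ * (x - t) ^ k) • iteratedDerivWithin k f (Icc a b) t‖ ≤
      C * (x - t) ^ (n + 1) / n ! := by
  have hC0 : 0 ≤ C := (norm_nonneg _).trans (hC t ht)
  -- At t = b the interval [t, b] is a single point and carries no unique derivatives, so this
  -- trivial case is separate.
  rcases eq_or_lt_of_le ht.2 with rfl | htb
  · obtain rfl : x = t := le_antisymm hx.2 hx.1
    rw [Finset.sum_eq_single 0]
    · simp
    · intro k _ hk
      simp [hk]
    · simp
  · have hab : a < b := ht.1.trans_lt htb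
    have hsub : Icc t b ⊆ Icc a b := Icc_subset_Icc_left ht.1
    have hder : ∀ k ≤ n + 1, ∀ y ∈ Icc t b,
        iteratedDerivWithin k f (Icc t b) y = iteratedDerivWithin k f (Icc a b) y := by
      intro k hk y hy
      rw [iteratedDerivWithin, iteratedDerivWithin, iteratedFDerivWithin_subset hsub
        (uniqueDiffOn_Icc htb) (uniqueDiffOn_Icc hab) (hf.of_le (by exact_mod_cast hk)) hy]
    have h1 := taylor_mean_remainder_bound htb.le (hf.mono hsub) hx fun y hy => by
      rw [hder _ le_rfl y hy]
      exact hC y (hsub hy)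
    rw [taylor_within_apply] at h1
    convert h1 using 4 with k hk
    rw [hder k (Finset.mem_range.1 hk).le t ⟨le_rfl, htb.le⟩]

theorem iteratedDerivWithin_comp_lineMap {g : X → Y} {U : Set X} (hU : IsOpen U) {n : ℕ}
    (hg : ContDiffOn ℝ n g U) {v w : X} (hvw : ∀ x ∈ Icc (0 : ℝ) 1, AffineMap.lineMap v w x ∈ U)
    {k : ℕ} (hk : k ≤ n) {x : ℝ} (hx : x ∈ Icc (0 : ℝ) 1) :
    iteratedDerivWithin k (fun x : ℝ => g (AffineMap.lineMap v w x)) (Icc 0 1) x =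
      iteratedFDeriv ℝ k g (AffineMap.lineMap v w x) fun _ => w - v := by
  have h1 := (hg.ftaylorSeriesWithin hU.uniqueDiffOn).comp_continuousAffineMap
    (ContinuousAffineMap.lineMap (R := ℝ) v w)
  have h2 := (h1.mono (t := Icc 0 1) hvw).eq_iteratedFDerivWithin_of_uniqueDiffOn
    (by exact_mod_cast hk) (uniqueDiffOn_Icc zero_lt_one) hx
  rw [iteratedDerivWithin]
  have h3 := congrArg (fun m => m fun _ => (1 : ℝ)) h2
  refine Eq.trans h3.symm ?_
  have h4 : iteratedFDerivWithin ℝ k g U (AffineMap.lineMap v w x) =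
      iteratedFDeriv ℝ k g (AffineMap.lineMap v w x) := iteratedFDerivWithin_of_isOpen k hU (hvw x hx)
  rw [← h4]
  simp [ftaylorSeriesWithin]
  rfl

/-- Taylor's formula along a segment. -/
theorem norm_sub_taylor_sum_segment_le {g : X → Y} {U : Set X} (hU : IsOpen U) {n : ℕ}
    (hg : ContDiffOn ℝ (n + 1 : ℕ) g U) {v w : X}
    (hvw : ∀ x ∈ Icc (0 : ℝ) 1, AffineMap.lineMap v w x ∈ U) {K : ℝ}
    (hK : ∀ z ∈ U, ‖iteratedFDeriv ℝ (n + 1) g z‖ ≤ K) :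
    ‖g w - ∑ k ∈ Finset.range (n + 1), (k ! : ℝ)⁻¹ • iteratedFDeriv ℝ k g v fun _ => w - v‖ ≤
      K * ‖w - v‖ ^ (n + 1) / n ! := by
  have hf : ContDiffOn ℝ (n + 1) (fun x : ℝ => g (AffineMap.lineMap v w x)) (Icc 0 1) := by
    have : ContDiff ℝ (n + 1 : ℕ) (ContinuousAffineMap.lineMap (R := ℝ) v w) :=
      ContinuousAffineMap.contDiff _
    exact_mod_cast hg.comp this.contDiffOn hvw
  have h1 := norm_sub_taylor_sum_le (C := K * ‖w - v‖ ^ (n + 1)) hf (fun y hy => by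
    rw [iteratedDerivWithin_comp_lineMap hU hg hvw le_rfl hy]
    refine (ContinuousMultilinearMap.le_of_opNorm_le (hK _ (hvw y hy)) _).trans ?_
    simp) (t := 0) (x := 1) (by simp) (by simp)
  have h2 : ∀ k ∈ Finset.range (n + 1), iteratedDerivWithin k
      (fun x : ℝ => g (AffineMap.lineMap v w x)) (Icc 0 1) 0 =
        iteratedFDeriv ℝ k g v fun _ => w - v := by
    intro k hk
    rw [iteratedDerivWithin_comp_lineMap hU hg hvw (Finset.mem_range.1 hk).le (by simp),
      AffineMap.lineMap_apply_zero]
  rw [Finset.sum_congr rfl fun k hk => by rw [h2 k hk]] at h1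
  simpa using h1

/-- The linearization remainder is Lipschitz near `v`, with a small constant. -/
theorem norm_linRemainder_sub_le {g : X → X} {U : Set X} (hU : IsOpen U)
    (hg : ContDiffOn ℝ 2 g U) {K : ℝ} (hK : ∀ z ∈ U, ‖iteratedFDeriv ℝ 2 g z‖ ≤ K) {v : X} {ρ : ℝ}
    (hρ : Metric.closedBall v ρ ⊆ U) {y z : X} (hy : y ∈ Metric.closedBall v ρ)
    (hz : z ∈ Metric.closedBall v ρ) :
    ‖linRemainder g v z - linRemainder g v y‖ ≤ K * ρ * ‖z - y‖ := by
  have hc : Convex ℝ (Metric.closedBall v ρ) := convex_closedBall v ρ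
  have hρ0 : 0 ≤ ρ := dist_nonneg.trans hy
  have hv : v ∈ Metric.closedBall v ρ := Metric.mem_closedBall_self hρ0
  have hK0 : 0 ≤ K := (norm_nonneg _).trans (hK v (hρ hv))
  have hd : ∀ x ∈ Metric.closedBall v ρ, DifferentiableAt ℝ g x := fun x hx =>
    (hg.contDiffAt (hU.mem_nhds (hρ hx))).differentiableAt (by norm_num)
  have hd2 : ∀ x ∈ Metric.closedBall v ρ, DifferentiableAt ℝ (fderiv ℝ g) x := fun x hx =>
    ((hg.contDiffAt (hU.mem_nhds (hρ hx))).fderiv_right (m := 1) (by norm_num)).differentiableAt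
      (by norm_num)
  -- The derivative of g_v at x is g'(x) - g'(v), small by the mean value inequality for g'.
  have h1 : ∀ x ∈ Metric.closedBall v ρ, ‖fderiv ℝ g x - fderiv ℝ g v‖ ≤ K * ρ := by
    intro x hx
    have := hc.norm_image_sub_le_of_norm_fderiv_le hd2 (fun x hx => by
      rw [← norm_iteratedFDeriv_one, norm_iteratedFDeriv_fderiv]
      exact hK x (hρ hx)) hv hx
    exact this.trans (mul_le_mul_of_nonneg_left (mem_closedBall_iff_norm.1 hx) hK0)
  have h2 := hc.norm_image_sub_le_of_norm_fderiv_le' hd h1 hy hz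
  have h3 : linRemainder g v z - linRemainder g v y = g z - g y - fderiv ℝ g v (z - y) := by
    simp only [linRemainder, map_sub]
    abel
  rwa [h3]

/-- Expansion of the second and third order Taylor terms of `g` along a curve. -/
theorem norm_taylor_terms_sub_le (b : X →L[ℝ] X →L[ℝ] Y) (hb : ∀ x y, b x y = b y x)
    (a : ContinuousMultilinearMap ℝ (fun _ : Fin 3 => X) Y) {K s : ℝ} (hs : s ∈ Icc (0 : ℝ) 1)
    (hbK : ‖b‖ ≤ K) (haK : ‖a‖ ≤ K) {δ u₁ u₂ : X} (hu₁ : ‖u₁‖ ≤ K) (hu₂ : ‖u₂‖ ≤ K)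
    (hδ : ‖δ‖ ≤ K * s) (hδ₂ : ‖δ - s • u₁ - (s ^ 2 / 2) • u₂‖ ≤ K / 2 * s ^ 3) :
    ‖(1 / 2 : ℝ) • b δ δ + (1 / 6 : ℝ) • a (fun _ => δ) - (s ^ 2 / 2) • b u₁ u₁ -
      (s ^ 3 / 6) • (a (fun _ => u₁) + (3 : ℝ) • b u₁ u₂)‖ ≤ (K ^ 3 + K ^ 4 / 2) * s ^ 4 := by
  have hK : 0 ≤ K := (norm_nonneg _).trans hu₁
  have hs0 := hs.1
  set ρ := δ - s • u₁ - (s ^ 2 / 2) • u₂ with hρ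
  set η := δ - s • u₁ with hη
  have hηρ : η = (s ^ 2 / 2) • u₂ + ρ := by rw [hρ]; abel
  have hδη : δ = s • u₁ + η := by rw [hη]; abel
  have hηn : ‖η‖ ≤ K * s ^ 2 := by
    rw [hηρ]
    have h1 : ‖(s ^ 2 / 2) • u₂‖ ≤ s ^ 2 / 2 * K := by
      rw [norm_smul, Real.norm_of_nonneg (by positivity)]
      gcongr
    have h2 : K / 2 * s ^ 3 ≤ K / 2 * s ^ 2 :=
      mul_le_mul_of_nonneg_left (pow_le_pow_of_le_one hs0 hs.2 (by norm_num)) (by positivity)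
    have := norm_add_le ((s ^ 2 / 2) • u₂) ρ
    linarith
  have hb2 : ∀ {x y : X} {p q : ℝ}, ‖x‖ ≤ p → ‖y‖ ≤ q → ‖b x y‖ ≤ K * p * q := fun hx hy =>
    ContinuousLinearMap.le_of_opNorm_le_of_le _
      (ContinuousLinearMap.le_of_opNorm_le_of_le _ hbK hx) hy
  -- By symmetry the two cross terms combine to (s³/2) b(u₁,u₂) = (s³/6)·3b(u₁,u₂), the origin of
  -- the factor 3 in the regularity term.
  have hquad : (1 / 2 : ℝ) • b δ δ - (s ^ 2 / 2) • b u₁ u₁ - (s ^ 3 / 2) • b u₁ u₂ =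
      s • b u₁ ρ + (1 / 2 : ℝ) • b η η := by
    have h1 : b u₁ η = (s ^ 2 / 2) • b u₁ u₂ + b u₁ ρ := by rw [hηρ, map_add, map_smul]
    have h2 : b δ δ = s ^ 2 • b u₁ u₁ + (2 * s) • b u₁ η + b η η := by
      rw [hδη]
      simp only [map_add, map_smul, _root_.add_apply, _root_.smul_apply]
      rw [hb η u₁]
      module
    rw [h2, h1]
    module
  have hq : ‖s • b u₁ ρ + (1 / 2 : ℝ) • b η η‖ ≤ K ^ 3 * s ^ 4 := by
    refine (norm_add_le _ _).trans ?_
    rw [norm_smul, norm_smul, Real.norm_of_nonneg hs0, Real.norm_of_nonneg (by norm_num)]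
    have h1 := mul_le_mul_of_nonneg_left (hb2 hu₁ hδ₂) hs0
    have h2 := hb2 hηn hηn
    calc _ ≤ s * (K * K * (K / 2 * s ^ 3)) + 1 / 2 * (K * (K * s ^ 2) * (K * s ^ 2)) := by
          gcongr
      _ = _ := by ring
  have hcub : ‖a (fun _ => δ) - s ^ 3 • a (fun _ => u₁)‖ ≤ 3 * K ^ 4 * s ^ 4 := by
    have h1 : s ^ 3 • a (fun _ => u₁) = a (fun _ => s • u₁) := by
      have := a.map_smul_univ (fun _ => s) (fun _ => u₁)
      simpa using this.symm
    rw [h1]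
    have hsu : ‖s • u₁‖ ≤ K * s := by
      rw [norm_smul, Real.norm_of_nonneg hs0, mul_comm]
      gcongr
    have hpi : ∀ {x : X} {p : ℝ}, 0 ≤ p → ‖x‖ ≤ p → ‖(fun _ : Fin 3 => x)‖ ≤ p := fun hp hx =>
      (pi_norm_le_iff_of_nonneg hp).2 fun _ => hx
    refine (a.norm_image_sub_le _ _).trans ?_
    have h2 : ‖(fun _ : Fin 3 => δ) - fun _ : Fin 3 => s • u₁‖ ≤ K * s ^ 2 :=
      hpi (by positivity) hηn
    have h3 : max ‖(fun _ : Fin 3 => δ)‖ ‖(fun _ : Fin 3 => s • u₁)‖ ≤ K * s :=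
      max_le (hpi (by positivity) hδ) (hpi (by positivity) hsu)
    have h4 : (Fintype.card (Fin 3) : ℝ) = 3 := by simp
    rw [h4, Fintype.card_fin]
    calc _ ≤ K * 3 * (K * s) ^ (3 - 1) * (K * s ^ 2) := by gcongr
      _ = _ := by ring
  have hsplit : (1 / 2 : ℝ) • b δ δ + (1 / 6 : ℝ) • a (fun _ => δ) - (s ^ 2 / 2) • b u₁ u₁ -
      (s ^ 3 / 6) • (a (fun _ => u₁) + (3 : ℝ) • b u₁ u₂) =
      (s • b u₁ ρ + (1 / 2 : ℝ) • b η η) +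
        (1 / 6 : ℝ) • (a (fun _ => δ) - s ^ 3 • a (fun _ => u₁)) := by
    rw [← hquad]
    module
  rw [hsplit]
  refine (norm_add_le _ _).trans ?_
  rw [norm_smul, Real.norm_of_nonneg (by norm_num)]
  linarith

end Taylor

/-! ### Expansion of the linearization remainder along the solution. -/

section Expansion

theorem ball_subset_thickening_image {α β : Type*} [PseudoMetricSpace α] {u : β → α} {s : Set β}
    {t : β} (ht : t ∈ s) (r : ℝ) : Metric.ball (u t) r ⊆ Metric.thickening r (u '' s) :=
  Metric.ball_subset_thickening (mem_image_of_mem u ht) r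

variable {X : Type*} [NormedAddCommGroup X] [NormedSpace ℝ X] {A : X →ₗ.[ℝ] X} {g : X → X}
  {u : ℝ → X} {t₀ T r K : ℝ}

namespace SmoothSolution

theorem bound_nonneg (hu : SmoothSolution A g u t₀ T r K) {t : ℝ} (ht : t ∈ Icc t₀ T) : 0 ≤ K :=
  (norm_nonneg _).trans (hu.bound_solution t ht 1 (by simp))

theorem iteratedDerivWithin_one (hu : SmoothSolution A g u t₀ T r K) (h : t₀ < T) {t : ℝ}
    (ht : t ∈ Icc t₀ T) : iteratedDerivWithin 1 u (Icc t₀ T) t =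
      vectorField A g ⟨u t, hu.mem_domain t ht⟩ := by
  rw [_root_.iteratedDerivWithin_one]
  exact (hu.equation t ht).derivWithin (uniqueDiffOn_Icc h t ht)

theorem norm_sub_le (hu : SmoothSolution A g u t₀ T r K) {t s : ℝ} (ht : t ∈ Icc t₀ T)
    (hs : 0 ≤ s) (hts : t + s ≤ T) : ‖u (t + s) - u t‖ ≤ K * s := by
  have := norm_sub_taylor_sum_le (n := 0) (f := u) (hu.contDiffOn_solution.of_le (by norm_num))
    (fun y hy => hu.bound_solution y hy 1 (by simp)) ht (x := t + s) ⟨by linarith, hts⟩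
  simpa using this

theorem norm_sub_sub_sub_le (hu : SmoothSolution A g u t₀ T r K) {t s : ℝ} (ht : t ∈ Icc t₀ T)
    (hs : 0 ≤ s) (hts : t + s ≤ T) :
    ‖u (t + s) - u t - s • iteratedDerivWithin 1 u (Icc t₀ T) t -
      (s ^ 2 / 2) • iteratedDerivWithin 2 u (Icc t₀ T) t‖ ≤ K / 2 * s ^ 3 := by
  have := norm_sub_taylor_sum_le (n := 2) (f := u)
    (hu.contDiffOn_solution.of_le (by norm_num))
    (fun y hy => hu.bound_solution y hy 3 (by simp)) ht (x := t + s) ⟨by linarith, hts⟩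
  simp only [Finset.sum_range_succ, Finset.sum_range_zero, add_sub_cancel_left] at this
  convert this using 2
  · simp [sub_sub, add_assoc, div_eq_inv_mul]
  · simp; ring

theorem norm_linRemainder_sub_le (hu : SmoothSolution A g u t₀ T r K) {t ρ : ℝ}
    (ht : t ∈ Icc t₀ T) (hρ : ρ < r) {y z : X} (hy : ‖y - u t‖ ≤ ρ) (hz : ‖z - u t‖ ≤ ρ) :
    ‖linRemainder g (u t) z - linRemainder g (u t) y‖ ≤ K * ρ * ‖z - y‖ :=
  _root_.norm_linRemainder_sub_le Metric.isOpen_thickening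
    (hu.contDiffOn_nonlinearity.of_le (by norm_num))
    (fun z hz => hu.bound_nonlinearity z hz 2 (by simp)) ((Metric.closedBall_subset_ball hρ).trans (ball_subset_thickening_image ht r))
    (mem_closedBall_iff_norm.2 hy) (mem_closedBall_iff_norm.2 hz)

theorem norm_linRemainder_solution_sub_le (hu : SmoothSolution A g u t₀ T r K) {t s : ℝ}
    (ht : t ∈ Icc t₀ T) (hs : 0 ≤ s) (hts : t + s ≤ T) (hr : K * s < r) :
    ‖linRemainder g (u t) (u (t + s)) - linRemainder g (u t) (u t)‖ ≤ K ^ 3 * s ^ 2 := by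
  have hK := hu.bound_nonneg ht
  have h1 := hu.norm_sub_le ht hs hts
  refine (hu.norm_linRemainder_sub_le ht hr (by simpa using mul_nonneg hK hs) h1).trans ?_
  calc _ ≤ K * (K * s) * (K * s) := by gcongr
    _ = _ := by ring

/-- Expansion of the linearization remainder along the solution. -/
theorem norm_linRemainder_expansion_le (hu : SmoothSolution A g u t₀ T r K) {t s : ℝ}
    (ht : t ∈ Icc t₀ T) (hs : s ∈ Icc (0 : ℝ) 1) (hts : t + s ≤ T) (hr : K * s < r) :
    ‖linRemainder g (u t) (u (t + s)) - linRemainder g (u t) (u t) -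
      (s ^ 2 / 2) • iteratedFDeriv ℝ 2 g (u t)
        (fun _ => iteratedDerivWithin 1 u (Icc t₀ T) t) -
      (s ^ 3 / 6) • regularityTerm g u t₀ T t‖ ≤ (K ^ 5 / 6 + K ^ 3 + K ^ 4 / 2) * s ^ 4 := by
  have hK := hu.bound_nonneg ht
  set v := u t with hv
  set δ := u (t + s) - v with hδ
  set u₁ := iteratedDerivWithin 1 u (Icc t₀ T) t
  set u₂ := iteratedDerivWithin 2 u (Icc t₀ T) t
  have hδK : ‖δ‖ ≤ K * s := hu.norm_sub_le ht hs.1 hts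
  have hvU : v ∈ Metric.thickening r (u '' Icc t₀ T) :=
    ball_subset_thickening_image ht r (Metric.mem_ball_self hu.radius_pos)
  have hgv : ContDiffAt ℝ 4 g v :=
    hu.contDiffOn_nonlinearity.contDiffAt (Metric.isOpen_thickening.mem_nhds hvU)
  -- A ball around v is used because it is convex, unlike the strip, and so contains the segment to
  -- u(t+s).
  have htaylor := norm_sub_taylor_sum_segment_le (n := 3) (U := Metric.ball v r) Metric.isOpen_ball
    (hu.contDiffOn_nonlinearity.mono (ball_subset_thickening_image ht r)) (v := v) (w := u (t + s))
    (fun x hx => (convex_ball v r).lineMap_mem (Metric.mem_ball_self hu.radius_pos)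
      (mem_ball_iff_norm.2 (hδK.trans_lt hr)) hx)
    (fun z hz => hu.bound_nonlinearity z (ball_subset_thickening_image ht r hz) 4 (by simp))
  set b := fderiv ℝ (fderiv ℝ g) v with hb
  have hsymm : ∀ x y, b x y = b y x := fun x y =>
    (hgv.isSymmSndFDerivAt (by simp; norm_num)).eq x y
  have hb2 : ∀ m : Fin 2 → X, iteratedFDeriv ℝ 2 g v m = b (m 0) (m 1) := fun m =>
    iteratedFDeriv_two_apply g v m
  have hterms := norm_taylor_terms_sub_le b hsymm (iteratedFDeriv ℝ 3 g v) hs (K := K)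
    (by
      rw [hb, ← norm_iteratedFDeriv_one, norm_iteratedFDeriv_fderiv]
      exact hu.bound_nonlinearity v hvU 2 (by simp))
    (hu.bound_nonlinearity v hvU 3 (by simp)) (hu.bound_solution t ht 1 (by simp))
    (hu.bound_solution t ht 2 (by simp)) hδK (hu.norm_sub_sub_sub_le ht hs.1 hts)
  have hreg : regularityTerm g u t₀ T t =
      iteratedFDeriv ℝ 3 g v (fun _ => u₁) + (3 : ℝ) • b u₁ u₂ := by
    have h3 : ![u₁, u₁, u₁] = fun _ => u₁ := by ext i; fin_cases i <;> rfl
    simp only [regularityTerm]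
    rw [h3, hb2]
    rfl
  simp only [Finset.sum_range_succ, Finset.sum_range_zero, hb2] at htaylor
  rw [hreg, hb2]
  -- The linear Taylor term g'(v)δ cancels against the one subtracted in g_v, leaving the Taylor
  -- remainder of g and the expansion of its quadratic and cubic terms.
  have hsplit : linRemainder g v (u (t + s)) - linRemainder g v v - (s ^ 2 / 2) • b u₁ u₁ -
      (s ^ 3 / 6) • (iteratedFDeriv ℝ 3 g v (fun _ => u₁) + (3 : ℝ) • b u₁ u₂) =
      (g (u (t + s)) - (g v + fderiv ℝ g v δ + (1 / 2 : ℝ) • b δ δ +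
        (1 / 6 : ℝ) • iteratedFDeriv ℝ 3 g v (fun _ => δ))) +
      ((1 / 2 : ℝ) • b δ δ + (1 / 6 : ℝ) • iteratedFDeriv ℝ 3 g v (fun _ => δ) -
        (s ^ 2 / 2) • b u₁ u₁ -
        (s ^ 3 / 6) • (iteratedFDeriv ℝ 3 g v (fun _ => u₁) + (3 : ℝ) • b u₁ u₂)) := by
    simp only [linRemainder, hδ, map_sub]
    abel
  rw [hsplit]
  refine (norm_add_le _ _).trans ?_
  have h1 : ‖g (u (t + s)) - (g v + fderiv ℝ g v δ + (1 / 2 : ℝ) • b δ δ +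
        (1 / 6 : ℝ) • iteratedFDeriv ℝ 3 g v (fun _ => δ))‖ ≤ K * (K * s) ^ 4 / 6 := by
    refine Eq.trans_le ?_ (htaylor.trans ?_)
    · congr 2
      simp [Nat.factorial, hδ]
    · have : ((3 ! : ℕ) : ℝ) = 6 := by norm_num [Nat.factorial]
      rw [this]
      gcongr
  calc _ ≤ K * (K * s) ^ 4 / 6 + (K ^ 3 + K ^ 4 / 2) * s ^ 4 := add_le_add h1 hterms
    _ = _ := by ring

end SmoothSolution

end Expansion

/-! ### The operators φ_k(hJ) for a generator J. -/

theorem integral_phi_weight (k : ℕ) : ∫ θ in (0 : ℝ)..1, θ ^ k / (k ! : ℝ) = ((k + 1)! : ℝ)⁻¹ := by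
  rw [intervalIntegral.integral_div, integral_pow, Nat.factorial_succ]
  push_cast
  field_simp
  simp

section PhiOperator

variable {X : Type*} [NormedAddCommGroup X] [NormedSpace ℝ X]

theorem GeneratesC0Semigroup.isC0Semigroup {A : X →ₗ.[ℝ] X} (hA : GeneratesC0Semigroup A) :
    IsC0Semigroup (expSemigroup A) := by
  rw [expSemigroup, dif_pos hA]
  exact hA.choose_spec.1

theorem GeneratesC0Semigroup.isGeneratorOf {A : X →ₗ.[ℝ] X} (hA : GeneratesC0Semigroup A) :
    IsGeneratorOf A (expSemigroup A) := by
  rw [expSemigroup, dif_pos hA]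
  exact hA.choose_spec.2

theorem phiOp_eq_phiFunctional (A : X →ₗ.[ℝ] X) (h : ℝ) (k : ℕ) (x : X) :
    phiOp A h k x = phiFunctional (fun s => expSemigroup A s x) h k := by
  cases k <;> rfl

/-- `h^{k+1} φ_{k+1}(hA) x = ∫_0^h s^k/k! e^{(h-s)A} x ds`. -/
theorem pow_smul_phiOp_succ (A : X →ₗ.[ℝ] X) (h : ℝ) (k : ℕ) (x : X) :
    h ^ (k + 1) • phiOp A h (k + 1) x =
      ∫ s in (0 : ℝ)..h, (s ^ k / (k ! : ℝ)) • expSemigroup A (h - s) x := by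
  have h1 := intervalIntegral.smul_integral_comp_mul_left (a := 0) (b := 1)
    (fun s => (s ^ k / (k ! : ℝ)) • expSemigroup A (h - s) x) h
  rw [mul_zero, mul_one] at h1
  rw [← h1, phiOp, pow_succ', mul_smul, ← intervalIntegral.integral_smul]
  congr 1
  refine intervalIntegral.integral_congr fun θ _ => ?_
  simp only [smul_smul]
  rw [mul_pow, mul_div_assoc, show (1 - θ) * h = h - h * θ by ring]

variable {J : X →ₗ.[ℝ] X} {h N : ℝ}

theorem continuousOn_orbit [CompleteSpace X] (hJ : IsC0Semigroup (expSemigroup J)) (x : X) (s : Set ℝ) (hs : s ⊆ Ici 0) :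
    ContinuousOn (fun r => expSemigroup J r x) s :=
  hJ.continuousOn_apply continuousOn_id hs continuousOn_const

theorem phiOp_add [CompleteSpace X] (hJ : IsC0Semigroup (expSemigroup J)) (hh : 0 ≤ h) (k : ℕ) (x y : X) :
    phiOp J h k (x + y) = phiOp J h k x + phiOp J h k y := by
  simp only [phiOp_eq_phiFunctional]
  cases k with
  | zero => simp [phiFunctional]
  | succ k =>
    simp only [phiFunctional]
    rw [← intervalIntegral.integral_add
      (intervalIntegrable_phi_integrand (continuousOn_orbit hJ x _ fun s hs => hs.1) hh le_rfl k)
      (intervalIntegrable_phi_integrand (continuousOn_orbit hJ y _ fun s hs => hs.1) hh le_rfl k)]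
    simp only [map_add, smul_add]

theorem phiOp_smul (k : ℕ) (c : ℝ) (x : X) : phiOp J h k (c • x) = c • phiOp J h k x := by
  cases k with
  | zero => simp [phiOp]
  | succ k =>
    simp only [phiOp]
    rw [← intervalIntegral.integral_smul]
    simp only [map_smul, smul_comm c]

theorem norm_phiOp_le (hh : 0 ≤ h) (hN : ∀ s ∈ Icc 0 h, ‖expSemigroup J s‖ ≤ N) (k : ℕ) (x : X) :
    ‖phiOp J h k x‖ ≤ N * ‖x‖ := by
  rw [phiOp_eq_phiFunctional]
  exact norm_phiFunctional_le hh
    (fun s hs => ContinuousLinearMap.le_of_opNorm_le _ (hN s hs) x) k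

/-- `φ_k(hJ) x = x / k! + O(h)` for `x` in the domain. -/
theorem norm_phiOp_sub_le [CompleteSpace X] (hJ : IsC0Semigroup (expSemigroup J))
    (hgen : IsGeneratorOf J (expSemigroup J)) (hh : 0 ≤ h)
    (hN : ∀ s ∈ Icc 0 h, ‖expSemigroup J s‖ ≤ N) (k : ℕ) (x : J.domain) :
    ‖phiOp J h (k + 1) x - ((k + 1)! : ℝ)⁻¹ • (x : X)‖ ≤ N * ‖J x‖ * h := by
  have hN0 : 0 ≤ N := (norm_nonneg _).trans (hN 0 ⟨le_rfl, hh⟩)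
  -- The weight has total mass 1/(k+1)!, so the difference is the same average taken of e^{sJ}x - x.
  have h1 : phiOp J h (k + 1) x - ((k + 1)! : ℝ)⁻¹ • (x : X) =
      phiFunctional (fun s => expSemigroup J s x - (x : X)) h (k + 1) := by
    rw [phiOp_eq_phiFunctional, ← integral_phi_weight, ← intervalIntegral.integral_smul_const]
    simp only [phiFunctional]
    rw [← intervalIntegral.integral_sub
      (intervalIntegrable_phi_integrand (continuousOn_orbit hJ x _ fun s hs => hs.1) hh le_rfl k)
      (by apply Continuous.intervalIntegrable; fun_prop)]
    simp only [smul_sub]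
  rw [h1]
  refine norm_phiFunctional_le hh (fun s hs => ?_) _
  refine (hgen.norm_apply_sub_le hJ x hs.1 fun r hr => hN r ⟨hr.1, hr.2.trans hs.2⟩).trans ?_
  exact mul_le_mul_of_nonneg_left hs.2 (by positivity)

theorem norm_integral_semigroup_le (hh : 0 ≤ h) (hN : ∀ s ∈ Icc 0 h, ‖expSemigroup J s‖ ≤ N)
    {f : ℝ → X} {C : ℝ} (hf : ∀ s ∈ Icc 0 h, ‖f s‖ ≤ C) :
    ‖∫ s in (0 : ℝ)..h, expSemigroup J (h - s) (f s)‖ ≤ N * C * h := by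
  have := intervalIntegral.norm_integral_le_of_norm_le_const (a := 0) (b := h) (C := N * C)
    (f := fun s => expSemigroup J (h - s) (f s)) fun s hs => by
      rw [uIoc_of_le hh] at hs
      exact ContinuousLinearMap.le_of_opNorm_le_of_le _
        (hN _ ⟨by linarith [hs.2], by linarith [hs.1]⟩) (hf s ⟨hs.1.le, hs.2⟩)
  rwa [sub_zero, abs_of_nonneg hh] at this

end PhiOperator

/-! ### The local error of one step. -/

section LocalError

variable {X : Type*} [NormedAddCommGroup X] [NormedSpace ℝ X] {A : X →ₗ.[ℝ] X} {g : X → X}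
  {u : ℝ → X} {t₀ T r K : ℝ}

namespace SmoothSolution

theorem continuousOn_linRemainder (hu : SmoothSolution A g u t₀ T r K) (v : X) :
    ContinuousOn (fun s => linRemainder g v (u s)) (Icc t₀ T) := by
  have h1 := hu.contDiffOn_solution.continuousOn
  have h2 : ContinuousOn (fun s => g (u s)) (Icc t₀ T) :=
    hu.contDiffOn_nonlinearity.continuousOn.comp h1 fun s hs =>
      ball_subset_thickening_image hs r (Metric.mem_ball_self hu.radius_pos)
  exact h2.sub ((fderiv ℝ g v).continuous.comp_continuousOn h1)

theorem continuousOn_linRemainder_shift (hu : SmoothSolution A g u t₀ T r K) {t τ : ℝ}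
    (ht : t ∈ Icc t₀ T) (htτ : t + τ ≤ T) :
    ContinuousOn (fun s => linRemainder g (u t) (u (t + s)) - linRemainder g (u t) (u t))
      (Icc 0 τ) :=
  ((hu.continuousOn_linRemainder (u t)).comp (by fun_prop : ContinuousOn (fun s => t + s) (Icc 0 τ))
    fun s hs => ⟨by linarith [ht.1, hs.1], by linarith [hs.2]⟩).sub continuousOn_const

variable [CompleteSpace X]

/-- The solution compared with the exponential Euler step. -/
theorem eq_exponential_euler_add (hu : SmoothSolution A g u t₀ T r K) {t τ : ℝ}
    (ht : t ∈ Icc t₀ T) (hJ : GeneratesC0Semigroup (jacobian A g (u t))) (hτ : 0 ≤ τ)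
    (htτ : t + τ ≤ T) :
    u (t + τ) = u t + τ • phiOp (jacobian A g (u t)) τ 1
        (vectorField A g ⟨u t, hu.mem_domain t ht⟩) +
      ∫ s in (0 : ℝ)..τ, expSemigroup (jacobian A g (u t)) (τ - s)
        (linRemainder g (u t) (u (t + s)) - linRemainder g (u t) (u t)) := by
  set v := u t with hv
  set J := jacobian A g v with hJdef
  set F := vectorField A g ⟨v, hu.mem_domain t ht⟩ with hF
  set D : ℝ → X := fun s => linRemainder g v (u (t + s)) - linRemainder g v v with hD
  have hDc : ContinuousOn D (Icc 0 τ) := hu.continuousOn_linRemainder_shift ht htτ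
  have hmem : ∀ s ∈ Icc (0 : ℝ) τ, t + s ∈ Icc t₀ T := fun s hs =>
    ⟨by linarith [ht.1, hs.1], by linarith [hs.2]⟩
  have huc : ContinuousOn (fun s => u (t + s)) (Icc 0 τ) :=
    hu.contDiffOn_solution.continuousOn.comp (by fun_prop) hmem
  have hS := hJ.isC0Semigroup
  -- The shifted solution y(s) = u(t+s) - v satisfies y' = Jy + F + D with y(0) = 0; the constant F
  -- produces the φ_1 term.
  have hvoc := hJ.isGeneratorOf.variation_of_constants hS (y := fun s => u (t + s) - v)
    (f := fun s => F + D s) hτ (huc.sub continuousOn_const) (continuousOn_const.add hDc)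
    fun s hs => by
      have hs' : s ∈ Icc (0 : ℝ) τ := ⟨hs.1, hs.2.le⟩
      have hw := hu.mem_domain _ (hmem s hs')
      refine ⟨A.domain.sub_mem hw (hu.mem_domain t ht), ?_⟩
      have h1 : HasDerivWithinAt u (vectorField A g ⟨u (t + s), hw⟩) (Ioi (t + s)) (t + s) := by
        refine (hu.equation _ (hmem s hs')).mono_of_mem_nhdsWithin ?_
        exact mem_of_superset (Ioc_mem_nhdsGT (by linarith [hs.2] : t + s < T))
          fun x hx => ⟨(hmem s hs').1.trans hx.1.le, hx.2⟩
      rw [hasDerivWithinAt_Ioi_iff_tendsto] at h1 ⊢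
      convert h1 using 1
      · ext δ
        rw [sub_sub_sub_cancel_right, add_assoc]
      · congr 1
        have h2 : J ⟨u (t + s) - v, A.domain.sub_mem hw (hu.mem_domain t ht)⟩ =
            fderiv ℝ g v (u (t + s) - v) +
              A (⟨u (t + s), hw⟩ - ⟨v, hu.mem_domain t ht⟩) := rfl
        rw [h2, LinearPMap.map_sub, hF, hD]
        simp only [vectorField, linRemainder, map_sub]
        abel
  rw [add_zero, ← hv, sub_self, map_zero, zero_add] at hvoc
  have hint : ∀ f : ℝ → X, ContinuousOn f (Icc 0 τ) →
      IntervalIntegrable (fun s => expSemigroup J (τ - s) (f s)) MeasureTheory.volume 0 τ := by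
    intro f hf
    apply ContinuousOn.intervalIntegrable
    rw [uIcc_of_le hτ]
    exact hS.continuousOn_apply (by fun_prop) (fun s hs => sub_nonneg.2 hs.2) hf
  simp only [map_add] at hvoc
  rw [intervalIntegral.integral_add (hint _ continuousOn_const) (hint _ hDc)] at hvoc
  have h1 := pow_smul_phiOp_succ J τ 0 F
  simp only [pow_zero, Nat.factorial_zero, Nat.cast_one, div_one, one_smul, zero_add, pow_one] at h1
  rw [h1, add_assoc, ← hvoc]
  abel

/-- The local error of the method with node `3/4` and weight `(32/9) φ_3`. -/
theorem norm_local_error_le (hu : SmoothSolution A g u t₀ T r K)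
    (hreg : RegularityCondition A g u t₀ T K) (hlt : t₀ < T) {t h N : ℝ} (ht : t ∈ Icc t₀ T)
    (hJ : GeneratesC0Semigroup (jacobian A g (u t))) (hh : 0 < h) (hh1 : h ≤ 1) (hth : t + h ≤ T)
    (hN1 : 1 ≤ N) (hN : ∀ s ∈ Icc 0 h, ‖expSemigroup (jacobian A g (u t)) s‖ ≤ N)
    (hr : N * K * h < r) {b : PhiCombination}
    (hb : ∀ x, b.onGenerator (jacobian A g (u t)) h x =
      (32 / 9 : ℝ) • phiOp (jacobian A g (u t)) h 3 x) :
    ‖rosenbrockStep A g (3 / 4) b h ⟨u t, hu.mem_domain t ht⟩ - u (t + h)‖ ≤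
      (32 / 9 * N * ((K ^ 5 / 6 + K ^ 3 + K ^ 4 / 2) + N ^ 2 * K ^ 5) +
        5 / 4 * N * (K + K * (K ^ 4 + 3 * K ^ 3)) +
        N * (K ^ 5 / 6 + K ^ 3 + K ^ 4 / 2)) * h ^ 5 := by
  have hK := hu.bound_nonneg ht
  set v : A.domain := ⟨u t, hu.mem_domain t ht⟩ with hv
  set J := jacobian A g (u t) with hJdef
  set F := vectorField A g v with hF
  set D : ℝ → X := fun s => linRemainder g (u t) (u (t + s)) - linRemainder g (u t) (u t) with hD
  set C₄ := K ^ 5 / 6 + K ^ 3 + K ^ 4 / 2 with hC₄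
  set a := iteratedFDeriv ℝ 2 g (u t) (fun _ => iteratedDerivWithin 1 u (Icc t₀ T) t) with ha
  set w := regularityTerm g u t₀ T t with hw
  have hS := hJ.isC0Semigroup
  have hC₄0 : 0 ≤ C₄ := by positivity
  have hNK : K * h ≤ N * K * h := by
    have : 0 ≤ K * h := by positivity
    nlinarith
  have hFK : ‖F‖ ≤ K := by
    rw [hF, hv, ← hu.iteratedDerivWithin_one hlt ht]
    exact hu.bound_solution t ht 1 (by simp)
  have hs1 : ∀ s ∈ Icc 0 h, K * s < r := fun s hs =>
    (mul_le_mul_of_nonneg_left hs.2 hK).trans_lt (hNK.trans_lt hr)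
  have hDexp : ∀ s ∈ Icc 0 h, ‖D s - (s ^ 2 / 2) • a - (s ^ 3 / 6) • w‖ ≤ C₄ * s ^ 4 :=
    fun s hs => hu.norm_linRemainder_expansion_le ht ⟨hs.1, hs.2.trans hh1⟩
      (by linarith [hs.2]) (hs1 s hs)
  have hDK : ∀ s ∈ Icc 0 h, ‖D s‖ ≤ K ^ 3 * s ^ 2 := fun s hs =>
    hu.norm_linRemainder_solution_sub_le ht hs.1 (by linarith [hs.2]) (hs1 s hs)
  have hDc : ContinuousOn D (Icc 0 h) := hu.continuousOn_linRemainder_shift ht hth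
  -- the internal stage
  obtain ⟨c, hc⟩ : ∃ c : ℝ, c = 3 / 4 := ⟨_, rfl⟩
  rw [← hc]
  have hch0 : 0 ≤ c * h := by rw [hc]; positivity
  have hchh : c * h ≤ h := by rw [hc]; linarith
  have hch : c * h ∈ Icc 0 h := ⟨hch0, hchh⟩
  set U := rosenbrockStage A g c h v with hU
  have hUeq : U = u t + (c * h) • phiOp J (c * h) 1 F := rfl
  have hNc : ∀ s ∈ Icc 0 (c * h), ‖expSemigroup J s‖ ≤ N := fun s hs =>
    hN s ⟨hs.1, hs.2.trans hchh⟩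
  have hUv : ‖U - u t‖ ≤ N * K * h := by
    rw [hUeq, add_sub_cancel_left, norm_smul, Real.norm_of_nonneg hch0]
    have h1 : ‖phiOp J (c * h) 1 F‖ ≤ N * K :=
      (norm_phiOp_le hch0 hNc 1 F).trans (mul_le_mul_of_nonneg_left hFK (by linarith))
    calc c * h * ‖phiOp J (c * h) 1 F‖ ≤ h * (N * K) := by gcongr
      _ = _ := by ring
  -- The stage is an exponential Euler step, so its error is an integral of D = O(h²) over length at
  -- most h.
  have hUu : ‖U - u (t + c * h)‖ ≤ N * K ^ 3 * h ^ 3 := by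
    have h1 := hu.eq_exponential_euler_add ht hJ hch0 (by linarith)
    have h2 : U - u (t + c * h) = -∫ s in (0 : ℝ)..c * h, expSemigroup J (c * h - s) (D s) := by
      rw [h1, hUeq]
      abel
    rw [h2, norm_neg]
    refine (norm_integral_semigroup_le hch0 hNc (C := K ^ 3 * h ^ 2) fun s hs => ?_).trans ?_
    · refine (hDK s ⟨hs.1, hs.2.trans hchh⟩).trans ?_
      have := hs.1
      have := hs.2.trans hchh
      gcongr
    · calc N * (K ^ 3 * h ^ 2) * (c * h) ≤ N * (K ^ 3 * h ^ 2) * h := by gcongr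
        _ = _ := by ring
  set G := linRemainder g (u t) U - linRemainder g (u t) (u t) with hG
  set R' := G - ((c * h) ^ 2 / 2) • a - ((c * h) ^ 3 / 6) • w with hR'
  -- Compared with D(ch), the stage error O(h³) is multiplied by the Lipschitz constant K·(NKh) of
  -- g_v on the ball containing both points.
  have hR'K : ‖R'‖ ≤ (C₄ + N ^ 2 * K ^ 5) * h ^ 4 := by
    have h1 : R' = (D (c * h) - ((c * h) ^ 2 / 2) • a - ((c * h) ^ 3 / 6) • w) +
        (linRemainder g (u t) U - linRemainder g (u t) (u (t + c * h))) := by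
      simp only [hR', hG, hD]
      abel
    have h2 := hDexp _ hch
    have h3 : C₄ * (c * h) ^ 4 ≤ C₄ * h ^ 4 := by gcongr
    have h4 := hu.norm_linRemainder_sub_le ht hr (y := u (t + c * h)) (z := U)
      ((hu.norm_sub_le ht hch0 (by linarith)).trans
        ((mul_le_mul_of_nonneg_left hchh hK).trans hNK)) hUv
    have h5 : K * (N * K * h) * ‖U - u (t + c * h)‖ ≤ N ^ 2 * K ^ 5 * h ^ 4 := by
      calc _ ≤ K * (N * K * h) * (N * K ^ 3 * h ^ 3) := by gcongr
        _ = _ := by ring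
    rw [h1]
    exact (norm_add_le _ _).trans ((add_le_add (h2.trans h3) (h4.trans h5)).trans
      (le_of_eq (by ring)))
  -- the regularity term
  obtain ⟨hwA, hwK⟩ := hreg t ht
  have hvU : u t ∈ Metric.thickening r (u '' Icc t₀ T) :=
    ball_subset_thickening_image ht r (Metric.mem_ball_self hu.radius_pos)
  have hwn : ‖w‖ ≤ K ^ 4 + 3 * K ^ 3 := by
    set u₁ := iteratedDerivWithin 1 u (Icc t₀ T) t
    set u₂ := iteratedDerivWithin 2 u (Icc t₀ T) t
    have hu₁ : ‖u₁‖ ≤ K := hu.bound_solution t ht 1 (by simp)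
    have hu₂ : ‖u₂‖ ≤ K := hu.bound_solution t ht 2 (by simp)
    have h1 : ‖iteratedFDeriv ℝ 3 g (u t) ![u₁, u₁, u₁]‖ ≤ K * (K * K * K) := by
      refine (ContinuousMultilinearMap.le_of_opNorm_le
        (hu.bound_nonlinearity _ hvU 3 (by simp)) _).trans ?_
      simp only [Fin.prod_univ_three]
      simp only [Matrix.cons_val]
      gcongr
    have h2 : ‖iteratedFDeriv ℝ 2 g (u t) ![u₁, u₂]‖ ≤ K * (K * K) := by
      refine (ContinuousMultilinearMap.le_of_opNorm_le
        (hu.bound_nonlinearity _ hvU 2 (by simp)) _).trans ?_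
      simp only [Fin.prod_univ_two]
      simp only [Matrix.cons_val]
      gcongr
    have h3 : w = iteratedFDeriv ℝ 3 g (u t) ![u₁, u₁, u₁] +
      (3 : ℝ) • iteratedFDeriv ℝ 2 g (u t) ![u₁, u₂] := rfl
    rw [h3]
    refine (norm_add_le _ _).trans ?_
    rw [norm_smul, Real.norm_of_nonneg (by norm_num)]
    linarith
  set w' : J.domain := ⟨w, hwA⟩ with hw'
  have hJw : ‖J w'‖ ≤ K + K * (K ^ 4 + 3 * K ^ 3) := by
    have h1 : J w' = fderiv ℝ g (u t) w + A ⟨w, hwA⟩ := rfl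
    have h2 : ‖fderiv ℝ g (u t)‖ ≤ K := by
      rw [← norm_iteratedFDeriv_one]
      exact hu.bound_nonlinearity _ hvU 1 (by simp)
    rw [h1, add_comm]
    exact (norm_add_le _ _).trans (add_le_add hwK
      (ContinuousLinearMap.le_of_opNorm_le_of_le _ h2 hwn))
  have hφ : ∀ k, ‖phiOp J h (k + 1) w - ((k + 1)! : ℝ)⁻¹ • w‖ ≤
      N * (K + K * (K ^ 4 + 3 * K ^ 3)) * h := fun k =>
    (norm_phiOp_sub_le hS hJ.isGeneratorOf hh.le hN k w').trans (by gcongr)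
  -- the solution
  set R : ℝ → X := fun s => D s - (s ^ 2 / 2) • a - (s ^ 3 / 6) • w with hR
  have hint : ∀ f : ℝ → X, ContinuousOn f (Icc 0 h) →
      IntervalIntegrable (fun s => expSemigroup J (h - s) (f s)) MeasureTheory.volume 0 h := by
    intro f hf
    apply ContinuousOn.intervalIntegrable
    rw [uIcc_of_le hh.le]
    exact hS.continuousOn_apply (by fun_prop) (fun s hs => sub_nonneg.2 hs.2) hf
  have hRc : ContinuousOn R (Icc 0 h) :=
    (hDc.sub (by fun_prop)).sub (by fun_prop)
  have hDint : ∫ s in (0 : ℝ)..h, expSemigroup J (h - s) (D s) =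
      h ^ 3 • phiOp J h 3 a + h ^ 4 • phiOp J h 4 w +
        ∫ s in (0 : ℝ)..h, expSemigroup J (h - s) (R s) := by
    have h1 : ∀ s, expSemigroup J (h - s) (D s) = expSemigroup J (h - s) ((s ^ 2 / 2) • a) +
        expSemigroup J (h - s) ((s ^ 3 / 6) • w) + expSemigroup J (h - s) (R s) := by
      intro s
      rw [← map_add, ← map_add]
      congr 1
      simp only [hR]
      abel
    simp only [h1]
    rw [intervalIntegral.integral_add ((hint _ (by fun_prop)).add (hint _ (by fun_prop)))
      (hint _ hRc), intervalIntegral.integral_add (hint _ (by fun_prop)) (hint _ (by fun_prop)),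
      pow_smul_phiOp_succ, pow_smul_phiOp_succ]
    simp only [map_smul, Nat.factorial]
    norm_num
  have hRint : ‖∫ s in (0 : ℝ)..h, expSemigroup J (h - s) (R s)‖ ≤ N * C₄ * h ^ 5 := by
    refine (norm_integral_semigroup_le hh.le hN (C := C₄ * h ^ 4) fun s hs => ?_).trans ?_
    · refine (hDexp s hs).trans ?_
      have := hs.1
      have := hs.2
      gcongr
    · exact le_of_eq (by ring)
  have hGeq : G = ((c * h) ^ 2 / 2) • a + ((c * h) ^ 3 / 6) • w + R' := by
    rw [hR']
    abel
  -- Here (32/9)·(9/16)/2 = 1 cancels the a-terms, and (32/9)·(27/64)/6 = 1/4 leaves φ_3/4 - φ_4 on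
  -- w. The values at 0 may be subtracted since (1/4)/3! = 1/4!.
  have hstep : rosenbrockStep A g c b h v - u (t + h) =
      h • ((32 / 9 : ℝ) • phiOp J h 3 R') +
      h ^ 4 • ((1 / 4 : ℝ) • (phiOp J h 3 w - ((2 + 1)! : ℝ)⁻¹ • w) -
        (phiOp J h 4 w - ((3 + 1)! : ℝ)⁻¹ • w)) -
      ∫ s in (0 : ℝ)..h, expSemigroup J (h - s) (R s) := by
    have h1 : rosenbrockStep A g c b h v =
        u t + h • phiOp J h 1 F + h • b.onGenerator J h G := rfl
    rw [h1, hb, hu.eq_exponential_euler_add ht hJ hh.le hth, hDint, hGeq,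
      phiOp_add hS hh.le, phiOp_add hS hh.le, phiOp_smul, phiOp_smul, hc]
    simp only [Nat.factorial]
    module
  rw [hstep]
  have e1 : ‖h • ((32 / 9 : ℝ) • phiOp J h 3 R')‖ ≤
      32 / 9 * N * (C₄ + N ^ 2 * K ^ 5) * h ^ 5 := by
    rw [norm_smul, norm_smul, Real.norm_of_nonneg hh.le, Real.norm_of_nonneg (by norm_num)]
    have h1 : ‖phiOp J h 3 R'‖ ≤ N * ((C₄ + N ^ 2 * K ^ 5) * h ^ 4) :=
      (norm_phiOp_le hh.le hN 3 R').trans (by gcongr)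
    calc _ ≤ h * (32 / 9 * (N * ((C₄ + N ^ 2 * K ^ 5) * h ^ 4))) := by gcongr
      _ = _ := by ring
  have e2 : ‖h ^ 4 • ((1 / 4 : ℝ) • (phiOp J h 3 w - ((2 + 1)! : ℝ)⁻¹ • w) -
        (phiOp J h 4 w - ((3 + 1)! : ℝ)⁻¹ • w))‖ ≤
      5 / 4 * N * (K + K * (K ^ 4 + 3 * K ^ 3)) * h ^ 5 := by
    rw [norm_smul, Real.norm_of_nonneg (by positivity)]
    have h1 := _root_.norm_sub_le ((1 / 4 : ℝ) • (phiOp J h 3 w - ((2 + 1)! : ℝ)⁻¹ • w))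
      (phiOp J h 4 w - ((3 + 1)! : ℝ)⁻¹ • w)
    rw [norm_smul, Real.norm_of_nonneg (by norm_num)] at h1
    have h2 := hφ 2
    have h3 := hφ 3
    calc _ ≤ h ^ 4 * (5 / 4 * (N * (K + K * (K ^ 4 + 3 * K ^ 3)) * h)) := by
          gcongr
          linarith
      _ = _ := by ring
  refine (_root_.norm_sub_le _ _).trans ((add_le_add ((norm_add_le _ _).trans (add_le_add e1 e2))
    hRint).trans (le_of_eq (by ring)))

end SmoothSolution

end LocalError

/-! ### Uniform constants and the solution of the order conditions. -/

section Final

/-- A uniform version of the local error bound. -/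
theorem exists_local_error_bound (M ω r K : ℝ) :
    ∃ C h₀ : ℝ, 0 < h₀ ∧ ∀ (X : Type*) [NormedAddCommGroup X] [NormedSpace ℝ X] [CompleteSpace X]
      (A : X →ₗ.[ℝ] X) (g : X → X) (u : ℝ → X) (t₀ T : ℝ), t₀ < T →
      GeneratesC0Semigroup A → ∀ hu : SmoothSolution A g u t₀ T r K,
      RegularityCondition A g u t₀ T K →
      (∀ s : ℝ, 0 ≤ s → ‖expSemigroup A s‖ ≤ M * Real.exp (ω * s)) →
      ∀ (b : PhiCombination) (t h : ℝ) (ht : t ∈ Icc t₀ T),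
        (∀ x, b.onGenerator (jacobian A g (u t)) h x =
          (32 / 9 : ℝ) • phiOp (jacobian A g (u t)) h 3 x) →
        0 < h → h ≤ h₀ → t + h ≤ T →
        ‖rosenbrockStep A g (3 / 4) b h ⟨u t, hu.mem_domain t ht⟩ - u (t + h)‖ ≤ C * h ^ 5 := by
  by_cases hp : 0 ≤ M ∧ 0 < r ∧ 0 ≤ K
  · obtain ⟨hM, hr, hK⟩ := hp
    -- N bounds e^{sA} on [0, 1], and 2N bounds the semigroup of J once NKh ≤ 1/2. The two fractions
    -- in h₀ enforce this and 2NKh < r, which keeps the stage in the strip; the added 1's keep the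
    -- denominators positive.
    set N := M * Real.exp |ω| + 1 with hN
    have hN1 : 1 ≤ N := by
      have : 0 ≤ M * Real.exp |ω| := by positivity
      linarith
    have hNK : 0 ≤ N * K := by positivity
    refine ⟨32 / 9 * (2 * N) * ((K ^ 5 / 6 + K ^ 3 + K ^ 4 / 2) + (2 * N) ^ 2 * K ^ 5) +
        5 / 4 * (2 * N) * (K + K * (K ^ 4 + 3 * K ^ 3)) +
        2 * N * (K ^ 5 / 6 + K ^ 3 + K ^ 4 / 2),
      min 1 (min (1 / (2 * (N * K + 1))) (r / (2 * N * K + 1))), by positivity, ?_⟩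
    intro X _ _ _ A g u t₀ T hlt hA hu hreg hbound b t h ht hb hh hh₀ hth
    have hh1 : h ≤ 1 := hh₀.trans (min_le_left _ _)
    have hh2 : N * K * h ≤ 1 / 2 := by
      have h1 := hh₀.trans ((min_le_right _ _).trans (min_le_left _ _))
      rw [le_div_iff₀ (by positivity)] at h1
      linarith
    have hh3 : 2 * N * K * h < r := by
      have h1 := hh₀.trans ((min_le_right _ _).trans (min_le_right _ _))
      rw [le_div_iff₀ (by positivity)] at h1
      linarith
    have hvU : u t ∈ Metric.thickening r (u '' Icc t₀ T) :=
      ball_subset_thickening_image ht r (Metric.mem_ball_self hu.radius_pos)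
    have hB : ‖fderiv ℝ g (u t)‖ ≤ K := by
      rw [← norm_iteratedFDeriv_one]
      exact hu.bound_nonlinearity _ hvU 1 (by simp)
    have hJ : GeneratesC0Semigroup (jacobian A g (u t)) := hA.vadd _
    refine hu.norm_local_error_le hreg hlt ht hJ hh hh1 hth (by linarith) ?_ hh3 hb
    refine hA.isGeneratorOf.norm_le_of_vadd hA.isC0Semigroup hJ.isC0Semigroup hJ.isGeneratorOf
      hh.le (fun s hs => ?_) ?_
    · refine (hbound s hs.1).trans ?_
      have h1 : ω * s ≤ |ω| := by
        calc ω * s ≤ |ω| * s := mul_le_mul_of_nonneg_right (le_abs_self ω) hs.1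
          _ ≤ |ω| * 1 := mul_le_mul_of_nonneg_left (hs.2.trans hh1) (abs_nonneg ω)
          _ = |ω| := mul_one _
      have h2 := mul_le_mul_of_nonneg_left (Real.exp_le_exp.2 h1) hM
      linarith
    · exact le_trans (by gcongr) hh2
  -- For other parameters the hypotheses cannot all hold, so any constants serve; M ≥ 0 follows from
  -- the bound at s = 0.
  · refine ⟨0, 1, one_pos, ?_⟩
    intro X _ _ _ A g u t₀ T hlt hA hu hreg hbound b t h ht
    refine absurd ⟨?_, hu.radius_pos, hu.bound_nonneg ht⟩ hp
    simpa using (norm_nonneg _).trans (hbound 0 le_rfl)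

variable {𝕜 : Type*} [RCLike 𝕜]

theorem phiMat_succ_zero (m k : ℕ) :
    phiMat (k + 1) (0 : Matrix (Fin m) (Fin m) 𝕜) = ((k + 1)! : ℝ)⁻¹ • (1 : Matrix (Fin m) (Fin m) 𝕜) := by
  ext i j
  simp only [phiMat, smul_zero, NormedSpace.exp_zero, Matrix.of_apply, Matrix.smul_apply]
  rw [intervalIntegral.integral_smul_const, integral_phi_weight]

/-- At Z = 0 the conditions read c²b(0) = 1/3 and c³b(0) = 1/4, whence c = 3/4. Then c² is
invertible and the first condition determines b. -/
theorem stiffOrderConditions_iff (c : ℝ)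
    (b : (m : ℕ) → Matrix (Fin m) (Fin m) 𝕜 → Matrix (Fin m) (Fin m) 𝕜) :
    StiffOrderConditions b c ↔
      c = 3 / 4 ∧ ∀ (m : ℕ) (Z : Matrix (Fin m) (Fin m) 𝕜), b m Z = (32 / 9 : ℝ) • phiMat 3 Z := by
  constructor
  · rintro ⟨h1, h2⟩
    have e1 := h1 1 0
    have e2 := h2 1
    rw [phiMat_succ_zero] at e1 e2
    have h3 : c ^ 3 • b 1 0 = c • (c ^ 2 • b 1 0) := by rw [smul_smul]; congr 1; ring
    rw [h3, e1, smul_smul, smul_smul, smul_smul] at e2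
    have e3 : c * 2 * ((2 + 1)! : ℝ)⁻¹ = 6 * ((3 + 1)! : ℝ)⁻¹ :=
      smul_left_injective ℝ (one_ne_zero : (1 : Matrix (Fin 1) (Fin 1) 𝕜) ≠ 0) (by
        simpa only [mul_assoc] using e2)
    norm_num [Nat.factorial] at e3
    have hc : c = 3 / 4 := by linarith
    refine ⟨hc, fun m Z => ?_⟩
    have h3 := h1 m Z
    rw [hc] at h3
    have h4 := congrArg (fun Y => (16 / 9 : ℝ) • Y) h3
    simp only [smul_smul] at h4
    norm_num at h4
    exact h4
  · rintro ⟨rfl, h⟩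
    refine ⟨fun m Z => ?_, fun m => ?_⟩
    · rw [h, smul_smul]
      norm_num
    · rw [h, phiMat_succ_zero, phiMat_succ_zero, smul_smul, smul_smul, smul_smul]
      norm_num [Nat.factorial]

end Final

end

theorem lemma4p1 {𝕜 : Type*} [RCLike 𝕜] :
    -- the unique solution of the order conditions
    (∀ (c₂ : ℝ) (b₂ : (m : ℕ) → Matrix (Fin m) (Fin m) 𝕜 → Matrix (Fin m) (Fin m) 𝕜),
      StiffOrderConditions b₂ c₂ ↔
        c₂ = 3 / 4 ∧ ∀ (m : ℕ) (Z : Matrix (Fin m) (Fin m) 𝕜),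
          b₂ m Z = (32 / 9 : ℝ) • phiMat 3 Z) ∧
    -- the local error bound; the constants depend only on the method and on the bounds `M, ω, r, K`
    (∀ (c₂ : ℝ) (b₂ : PhiCombination),
      StiffOrderConditions (𝕜 := 𝕜) (fun m Z => b₂.onMatrix m Z) c₂ →
      ∃ C h₀ : ℝ → ℝ → ℝ → ℝ → ℝ, (∀ M ω r K : ℝ, 0 < h₀ M ω r K) ∧
        ∀ (X : Type*) [NormedAddCommGroup X] [NormedSpace ℝ X] [CompleteSpace X]
          (A : X →ₗ.[ℝ] X) (g : X → X) (u : ℝ → X) (t₀ T r K : ℝ), t₀ < T →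
          GeneratesC0Semigroup A →
          ∀ hu : SmoothSolution A g u t₀ T r K,
          RegularityCondition A g u t₀ T K →
          (∀ t ∈ Icc t₀ T, GeneratesC0Semigroup (jacobian A g (u t))) ∧
          (∃ M ω : ℝ, ∀ s : ℝ, 0 ≤ s → ‖expSemigroup A s‖ ≤ M * Real.exp (ω * s)) ∧
          ∀ M ω : ℝ, (∀ s : ℝ, 0 ≤ s → ‖expSemigroup A s‖ ≤ M * Real.exp (ω * s)) →
            ∀ (t h : ℝ) (ht : t ∈ Icc t₀ T), 0 < h → h ≤ h₀ M ω r K → t + h ≤ T →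
              ‖rosenbrockStep A g c₂ b₂ h ⟨u t, hu.mem_domain t ht⟩ - u (t + h)‖
                ≤ C M ω r K * h ^ 5) := by
  refine ⟨stiffOrderConditions_iff, fun c₂ b₂ hb => ?_⟩
  obtain ⟨rfl, hb₂⟩ := (stiffOrderConditions_iff _ _).1 hb
  choose C h₀ hpos hbound using exists_local_error_bound
  refine ⟨C, h₀, hpos, ?_⟩
  intro X _ _ _ A g u t₀ T r K hlt hA hu hreg
  have hJ : ∀ t ∈ Icc t₀ T, GeneratesC0Semigroup (jacobian A g (u t)) := fun t _ => hA.vadd _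
  refine ⟨hJ, hA.isC0Semigroup.exists_exp_bound, ?_⟩
  intro M ω hM t h ht hh hh₀ hth
  -- The hypothesis identifies b₂ on matrices only; the density argument turns this into the
  -- identity for J(u(t)).
  exact hbound M ω r K X A g u t₀ T hlt hA hu hreg hM b₂ t h ht
    (fun x => PhiCombination.onGenerator_eq_of_onMatrix_eq hb₂ (hJ t ht).isC0Semigroup hh.le x)
    hh hh₀ hth
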